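/- Let $\Omega\subset\mathbb R^3$ be a bounded Lipschitz domain, divided into finitely many pairwise disjoint Lipschitz subdomains $\Omega_i\subseteq\Omega$ with $\Omega\subseteq\bigcup_i\overline{\Omega_i}$. Let the bulk modulus $\kappa>0$ and the density $\rho>0$ be continuous up to the boundary and positive on each $\overline{\Omega_i}$ (they may jump across the interfaces), and let $c=\sqrt{\kappa/\rho}$. For $\eta=x,y,z$ let $d_\eta\ge 0$ be a continuous function of the coordinate $\eta$ alone, which is continuously differentiable at the points of the subdomains. Suppose that $$\beta=\sup_{\eta=x,y,z;\ \bigcup_i\Omega_i}\sqrt{\kappa/\rho}\,\Big|\frac{d_\eta'(\eta)}{d_\eta(\eta)}\Big|$$ is finite, where the quotient is read as $0$ at points with $d_\eta=0$ (there $d_\eta'=0$ too). Let $s=a+ib\in\mathbb C$ with $a=\mathrm{Re}(s)>\beta$, and let $r\in\mathbb R$ with $|r|\le1$. Put $$S_\eta=1+\frac{d_\eta}{s},\qquad \nabla_d=\Big(\tfrac1{S_x}\partial_x,\tfrac1{S_y}\partial_y,\tfrac1{S_z}\partial_z\Big)^T,\qquad \mathbf S=\mathrm{diag}(S_yS_z,S_xS_z,S_xS_y),\qquad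 k_\eta=\frac{2d_\eta b^2}{|sS_\eta|^2}.$$ Let $F\in L^2(\Omega)$, and let $f=(f_x,f_y,f_z)$ be complex-valued and, on each subdomain, continuously differentiable inside and continuous up to the boundary; let $f\cdot\mathbf n$ be continuous across the interfaces and, if $r\ne-1$, let $f\cdot\mathbf n=0$ on $\partial\Omega$ ($\mathbf n$ is a unit normal, outward on $\partial\Omega$). Let $u$ be a complex-valued function which on each subdomain is continuously differentiable up to the boundary, with flux $\mathbf S\frac1\rho\nabla_d u$ continuously differentiable inside, and which solves $$\frac{s^2S_xS_yS_z}{\kappa}u-\nabla\cdot\Big(\mathbf S\frac1\rho\nabla_d u\Big)=\frac{S_xS_yS_z}{\kappa}F+S_xS_yS_z\,\nabla\cdot f\quad\text{in each }\Omega_i,$$ with the boundary condition $$S_xS_yS_z\Big(\frac{1-r}2\,c\,\Big(\sum_\eta\frac{n_\eta^2}{S_\eta}\Big)su+\frac{r+1}2\,\frac1\rho\sum_\eta\frac{n_\eta}{S_\eta^2}\frac{\partial u}{\partial\eta}\Big)=0\quad\text{on }\partial\Omega$$ and the interface conditions $[\![u]\!]=0$, $[\![(\mathbf S\frac1\rho\nabla_d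 u)\cdot\mathbf n]\!]=0$ on the interfaces between the subdomains (the boundary, interface and normal conditions are required where the normals exist, hence almost everywhere). With $\|v\|_w^2=\int_\Omega w|v|^2\,dx$ define $E_u,E_f\ge0$ by $$E_u^2=\|su\|_{1/\kappa}^2+\sum_\eta\Big\|\frac1{S_\eta}\frac{\partial u}{\partial\eta}\Big\|_{1/\rho}^2,\qquad E_f^2=\|F\|_{1/\kappa}^2+\sum_\eta\|sS_\eta f_\eta\|_\rho^2 .$$ Then $$(a-\beta)E_u^2+\sum_{\eta}\Big\|\frac1{S_\eta}\frac{\partial u}{\partial\eta}\Big\|_{k_\eta/\rho}^2+BT_r(u)\le 2E_uE_f ,$$ where $BT_{-1}(u)=0$ and, for $r\neq-1$, $$BT_r(u)=\int_{\partial\Omega}\frac{1-r}{1+r}\,c\,|su|^2\sum_\eta\frac{a(a+d_\eta)+b^2}{(a+d_\eta)^2+b^2}\,n_\eta^2\,dS ;$$ the integrand is integrable and $BT_r(u)\ge0$. -/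

import Mathlib

open scoped MeasureTheory Topology

noncomputable section

namespace PML

/-- Physical space `ℝ³` with its Euclidean norm; the coordinates `x, y, z` are `0, 1, 2 : Fin 3`. -/
abbrev E3 := EuclideanSpace ℝ (Fin 3)

/-! ### Geometry -/

/-- `A ⊆ ℝ³` is a bounded open set with Lipschitz boundary: near every boundary point, after an
isometric change of Cartesian coordinates `ℝ³ ≅ ℝ² × ℝ`, the set is the part strictly below the
graph of a Lipschitz function. -/
structure IsLipschitzDomain (A : Set E3) : Prop where
  isOpen : IsOpen A
  isBounded : Bornology.IsBounded A
  local_graph : ∀ x ∈ frontier A,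
    ∃ (U : Set E3) (e : E3 ≃ₗᵢ[ℝ] WithLp 2 (EuclideanSpace ℝ (Fin 2) × ℝ))
      (g : EuclideanSpace ℝ (Fin 2) → ℝ) (K : NNReal),
      IsOpen U ∧ x ∈ U ∧ LipschitzWith K g ∧ ∀ y ∈ U, (y ∈ A ↔ (e y).snd < g (e y).fst)

/-- `n` is the outward unit normal of `A` at the boundary point `x`: up to cones of arbitrarily
small opening around the tangent plane `x + n^⊥`, the set `A` near `x` is the half space
`⟪n, y - x⟫ < 0`. Such an `n` is unique, and for a Lipschitz domain it exists at almost every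
boundary point. -/
def IsOutwardNormal (A : Set E3) (x n : E3) : Prop :=
  x ∈ frontier A ∧ ‖n‖ = 1 ∧
    ∀ ε : ℝ, 0 < ε → ∀ᶠ y in 𝓝 x,
      (inner ℝ n (y - x) < -(ε * ‖y - x‖) → y ∈ A) ∧
      (ε * ‖y - x‖ < inner ℝ n (y - x) → y ∉ A)

open Classical in
/-- The outward unit normal field of `A` (`0` at points where there is no normal). -/
def outwardNormal (A : Set E3) (x : E3) : E3 :=
  if h : ∃ n, IsOutwardNormal A x n then h.choose else 0

/-- `Ω` is a bounded Lipschitz domain, split up to boundaries into finitely many pairwise disjoint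
Lipschitz subdomains `Ωp i`; across their common boundaries the medium may be discontinuous. -/
structure IsPartition {ι : Type*} (Ω : Set E3) (Ωp : ι → Set E3) : Prop where
  lipschitz : IsLipschitzDomain Ω
  lipschitz_piece : ∀ i, IsLipschitzDomain (Ωp i)
  subset : ∀ i, Ωp i ⊆ Ω
  disjoint : ∀ i j, i ≠ j → Disjoint (Ωp i) (Ωp j)
  cover : Ω ⊆ ⋃ i, closure (Ωp i)

/-! ### Medium and damping -/

/-- A positive coefficient that is continuous up to the boundary on each subdomain; `κ i` holds its
values (and one-sided limits) on the closure of `Ωp i`. -/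
def IsPiecewiseCoefficient {ι : Type*} (Ωp : ι → Set E3) (κ : ι → E3 → ℝ) : Prop :=
  ∀ i, ContinuousOn (κ i) (closure (Ωp i)) ∧ ∀ x ∈ closure (Ωp i), 0 < κ i x

/-- Damping functions `d η`, each a function of the coordinate `η` alone: nonnegative, continuous,
and continuously differentiable inside the subdomains. -/
structure IsDamping {ι : Type*} (Ωp : ι → Set E3) (d : Fin 3 → ℝ → ℝ) : Prop where
  continuous : ∀ η, Continuous (d η)
  nonneg : ∀ η t, 0 ≤ d η t
  contDiffAt : ∀ i, ∀ x ∈ Ωp i, ∀ η, ContDiffAt ℝ 1 (d η) (x η)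

/-- The values `√(κ/ρ) |d_η'/d_η|` over all coordinates `η` and all points of the subdomains.
Where `d_η = 0` (hence `d_η' = 0`, as `d_η ≥ 0`) the quotient is read as `0`, which is also Lean's
convention. -/
def betaValues {ι : Type*} (Ωp : ι → Set E3) (κ ρ : ι → E3 → ℝ) (d : Fin 3 → ℝ → ℝ) : Set ℝ :=
  {v | ∃ i, ∃ x ∈ Ωp i, ∃ η,
    v = Real.sqrt (κ i x / ρ i x) * |deriv (d η) (x η) / d η (x η)|}

/-! ### The reduced equation in Laplace space -/

/-- The complex stretching factor `S_η = 1 + d_η / s` at the point `x`. -/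
def S (d : Fin 3 → ℝ → ℝ) (s : ℂ) (η : Fin 3) (x : E3) : ℂ := 1 + (d η (x η) : ℂ) / s

/-- The product `S_x S_y S_z`. -/
def Sprod (d : Fin 3 → ℝ → ℝ) (s : ℂ) (x : E3) : ℂ := ∏ η, S d s η x

/-- The partial derivative `∂g/∂η` at `x`, one-sided (from inside `A`) at boundary points of `A`. -/
def pderivWithin (A : Set E3) (η : Fin 3) (g : E3 → ℂ) (x : E3) : ℂ :=
  fderivWithin ℝ g A x (EuclideanSpace.single η 1)

/-- The stretched derivative `(1/S_η) ∂u/∂η`, i.e. the component `η` of `∇_d u`, on `closure A`. -/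
def stretchedGrad (A : Set E3) (d : Fin 3 → ℝ → ℝ) (s : ℂ) (u : E3 → ℂ) (η : Fin 3) (x : E3) : ℂ :=
  1 / S d s η x * pderivWithin (closure A) η u x

/-- The component `η` of the flux `𝐒 (1/ρ) ∇_d u`, where `𝐒 = diag(S_y S_z, S_x S_z, S_x S_y)`. -/
def flux (A : Set E3) (ρ : E3 → ℝ) (d : Fin 3 → ℝ → ℝ) (s : ℂ) (u : E3 → ℂ)
    (η : Fin 3) (x : E3) : ℂ :=
  (∏ ξ ∈ Finset.univ.erase η, S d s ξ x) * (1 / (ρ x : ℂ)) * stretchedGrad A d s u η x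

/-- Admissible forcing data `F`, `f = (f_x, f_y, f_z)`: on each subdomain `F` is square integrable
and `f` is continuous up to the boundary and continuously differentiable inside; the normal
component of `f` is continuous across interfaces and, unless `r = -1` (Dirichlet condition),
vanishes on the outer boundary. -/
structure IsAdmissibleData {ι : Type*} (Ω : Set E3) (Ωp : ι → Set E3) (r : ℝ)
    (F : ι → E3 → ℂ) (f : ι → Fin 3 → E3 → ℂ) : Prop where
  memLp : ∀ i, MeasureTheory.MemLp (F i) 2 (MeasureTheory.volume.restrict (Ωp i))
  continuousOn : ∀ i η, ContinuousOn (f i η) (closure (Ωp i))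
  contDiffOn : ∀ i η, ContDiffOn ℝ 1 (f i η) (Ωp i)
  normal_jump : ∀ i j, i ≠ j → ∀ x ∈ Ω, ∀ n : E3,
    IsOutwardNormal (Ωp i) x n → IsOutwardNormal (Ωp j) x (-n) →
      ∑ η, f i η x * (n η : ℂ) = ∑ η, f j η x * (n η : ℂ)
  normal_boundary : r ≠ -1 → ∀ i, ∀ x n : E3,
    IsOutwardNormal Ω x n → IsOutwardNormal (Ωp i) x n → ∑ η, f i η x * (n η : ℂ) = 0

/-- `u` is a (piecewise classical) solution of the Laplace transformed PML equation
`(s² S_x S_y S_z / κ) u - div(𝐒 (1/ρ) ∇_d u) = (S_x S_y S_z / κ) F + S_x S_y S_z div f`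
with its boundary condition and interface conditions; `u i` is `u` on the closure of `Ωp i`. -/
structure IsSolution {ι : Type*} (Ω : Set E3) (Ωp : ι → Set E3) (κ ρ : ι → E3 → ℝ)
    (d : Fin 3 → ℝ → ℝ) (r : ℝ) (s : ℂ) (F : ι → E3 → ℂ) (f : ι → Fin 3 → E3 → ℂ)
    (u : ι → E3 → ℂ) : Prop where
  /-- `u` is continuously differentiable up to the boundary of each subdomain. -/
  contDiffOn : ∀ i, ContDiffOn ℝ 1 (u i) (closure (Ωp i))
  /-- The flux is continuously differentiable inside each subdomain. -/
  contDiffOn_flux : ∀ i η, ContDiffOn ℝ 1 (flux (Ωp i) (ρ i) d s (u i) η) (Ωp i)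
  /-- The differential equation. -/
  equation : ∀ i, ∀ x ∈ Ωp i,
    s ^ 2 * Sprod d s x / (κ i x : ℂ) * u i x
        - ∑ η, pderivWithin (Ωp i) η (flux (Ωp i) (ρ i) d s (u i) η) x
      = Sprod d s x / (κ i x : ℂ) * F i x
        + Sprod d s x * ∑ η, pderivWithin (Ωp i) η (f i η) x
  /-- The boundary condition, with wave speed `c = √(κ/ρ)`. -/
  boundary : ∀ i, ∀ x n : E3, IsOutwardNormal Ω x n → IsOutwardNormal (Ωp i) x n →
    Sprod d s x *
      ((1 - (r : ℂ)) / 2 * (Real.sqrt (κ i x / ρ i x) : ℂ)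
          * (∑ η, (n η : ℂ) ^ 2 / S d s η x) * (s * u i x)
        + ((r : ℂ) + 1) / 2 * (1 / (ρ i x : ℂ))
          * ∑ η, (n η : ℂ) / S d s η x ^ 2 * pderivWithin (closure (Ωp i)) η (u i) x) = 0
  /-- The interface condition `[[u]] = 0`. -/
  jump : ∀ i j, i ≠ j → ∀ x ∈ Ω, x ∈ frontier (Ωp i) → x ∈ frontier (Ωp j) → u i x = u j x
  /-- The interface condition `[[(𝐒 (1/ρ) ∇_d u) · n]] = 0`. -/
  flux_jump : ∀ i j, i ≠ j → ∀ x ∈ Ω, ∀ n : E3,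
    IsOutwardNormal (Ωp i) x n → IsOutwardNormal (Ωp j) x (-n) →
      ∑ η, flux (Ωp i) (ρ i) d s (u i) η x * (n η : ℂ)
        = ∑ η, flux (Ωp j) (ρ j) d s (u j) η x * (n η : ℂ)

/-! ### Energies -/

/-- `‖v‖²_b = ∫_Ω b |v|²`, as the sum over the subdomains. -/
def normSq {ι : Type*} [Fintype ι] (Ωp : ι → Set E3) (b : ι → E3 → ℝ) (v : ι → E3 → ℂ) : ℝ :=
  ∑ i, ∫ x in Ωp i, b i x * ‖v i x‖ ^ 2

/-- `E_u² = ‖s u‖²_{1/κ} + ∑_η ‖(1/S_η) ∂u/∂η‖²_{1/ρ}`. -/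
def energyUSq {ι : Type*} [Fintype ι] (Ωp : ι → Set E3) (κ ρ : ι → E3 → ℝ)
    (d : Fin 3 → ℝ → ℝ) (s : ℂ) (u : ι → E3 → ℂ) : ℝ :=
  normSq Ωp (fun i x => 1 / κ i x) (fun i x => s * u i x)
    + ∑ η, normSq Ωp (fun i x => 1 / ρ i x) (fun i x => stretchedGrad (Ωp i) d s (u i) η x)

/-- `E_f² = ‖F‖²_{1/κ} + ∑_η ‖s S_η f_η‖²_ρ`. -/
def energyFSq {ι : Type*} [Fintype ι] (Ωp : ι → Set E3) (κ ρ : ι → E3 → ℝ)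
    (d : Fin 3 → ℝ → ℝ) (s : ℂ) (F : ι → E3 → ℂ) (f : ι → Fin 3 → E3 → ℂ) : ℝ :=
  normSq Ωp (fun i x => 1 / κ i x) F
    + ∑ η, normSq Ωp ρ (fun i x => s * S d s η x * f i η x)

/-- `k_η = 2 d_η b² / |s S_η|²` with `b = Im s`. -/
def kcoef (d : Fin 3 → ℝ → ℝ) (s : ℂ) (η : Fin 3) (x : E3) : ℝ :=
  2 * d η (x η) * s.im ^ 2 / ‖s * S d s η x‖ ^ 2

/-- The integrand of the boundary term for `r ≠ -1`:
`((1-r)/(1+r)) c |s u|² ∑_η (a(a+d_η)+b²)/((a+d_η)²+b²) n_η²`, where `s = a + i b`, and `n` is the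
outward unit normal of `Ω`. -/
def boundaryIntegrand (Ω : Set E3) (κ ρ : E3 → ℝ) (d : Fin 3 → ℝ → ℝ) (r : ℝ) (s : ℂ)
    (u : E3 → ℂ) (x : E3) : ℝ :=
  (1 - r) / (1 + r) * Real.sqrt (κ x / ρ x) * ‖s * u x‖ ^ 2
    * ∑ η, (s.re * (s.re + d η (x η)) + s.im ^ 2) / ((s.re + d η (x η)) ^ 2 + s.im ^ 2)
        * outwardNormal Ω x η ^ 2

open Classical in
/-- The boundary term `BT_r(u)`. The surface measure is the two-dimensional Hausdorff measure; the
boundary `∂Ω` is, up to null sets, the disjoint union of its parts `∂Ω ∩ ∂Ωp i`. -/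
def boundaryTerm {ι : Type*} [Fintype ι] (Ω : Set E3) (Ωp : ι → Set E3) (κ ρ : ι → E3 → ℝ)
    (d : Fin 3 → ℝ → ℝ) (r : ℝ) (s : ℂ) (u : ι → E3 → ℂ) : ℝ :=
  if r = -1 then 0 else
    ∑ i, ∫ x in frontier Ω ∩ frontier (Ωp i),
      boundaryIntegrand Ω (κ i) (ρ i) d r s (u i) x ∂μHE[2]

end PML

end

/-! The estimate is an energy balance. Divide the equation by S_x S_y S_z, multiply by the conjugate
of su and take real parts; equivalently, compute the divergence of V_η = Re((Φ_η/(S_xS_yS_z) + f_η)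
conj(su)), where Φ is the flux. Write p_η = (1/S_η) ∂_η u. The mass term gives a|su|²/κ. The
gradient term is |p_η|²/ρ times conj(z)s/z with z = s + d_η, and its real part is a + k_η. What is
left is the work of F and f, and a commutator, since 1/(S_xS_yS_z) does not commute with ∂_η when
d_η varies.

The commutator has modulus |d_η'| |s| |p_η| |su| / (ρ|s+d_η|²). Since |s+d_η|² ≥ 2 d_η|s|, the
definition of β and the arithmetic-geometric mean inequality bound it by (β/4)(|su|²/κ + |p_η|²/ρ)
(`norm_commutator_le`). The sum over the three coordinates is at most β times the energy density.
This is `abs_divergence_energyField_sub_le`.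

Integrate over each subdomain. Across interfaces u, Φ·n and f·n are continuous, so the surface terms
cancel in pairs (`IsPartition.sum_flux_eq_zero`). On ∂Ω the boundary condition turns V·n into minus
the integrand of the boundary term (`sum_energyField_mul_eq_neg_boundaryIntegrand`). Young's
inequality with a free parameter l, optimised after integration, bounds the work by E_u E_f
(`workDensity_le`, `le_sqrt_mul_sqrt`). The constant obtained is 1, better than the stated 2.

Most of the file proves the divergence theorem for Lipschitz domains, with Hausdorff measure on the
boundary and fields that are C¹ only inside (`IsLipschitzDomain.integral_divergence`). It rests on
the area formula for Lipschitz graphs (`measure_graphMap_image`), on Rademacher's theorem for the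
normals, on the divergence theorem below a graph (`integral_fderiv_below_graph`), and on a partition
of unity. -/

noncomputable section

namespace PML

section

open MeasureTheory Measure Set Filter Function
open scoped NNReal ENNReal

/-! ### The area formula for Lipschitz graphs -/

/-- The plane of parameters of a graph. -/
abbrev E2 := EuclideanSpace ℝ (Fin 2)

/-- The Euclidean product of the plane and the vertical line. -/
abbrev P3 := WithLp 2 (E2 × ℝ)

/-- The map h x ↦ f x is C-Lipschitz on the image of h. It is well defined without injectivity of h,
because the hypothesis makes f constant on the fibres of h. This compares two parametrised surfaces
directly. -/
theorem euclideanHausdorffMeasure_image_le_of_dist_le {α X Y : Type*} [MetricSpace X]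
    [MeasurableSpace X] [BorelSpace X] [MetricSpace Y] [MeasurableSpace Y] [BorelSpace Y]
    {f : α → X} {h : α → Y} {s : Set α} {C : ℝ≥0} (k : ℕ)
    (hfh : ∀ x ∈ s, ∀ y ∈ s, dist (f x) (f y) ≤ C * dist (h x) (h y)) :
    μHE[k] (f '' s) ≤ (C : ℝ≥0∞) ^ k * μHE[k] (h '' s) := by
  rcases s.eq_empty_or_nonempty with rfl | ⟨x₀, hx₀⟩
  · simp
  have : Nonempty α := ⟨x₀⟩
  have hinv : ∀ z ∈ h '' s, invFunOn h s z ∈ s ∧ h (invFunOn h s z) = z := fun z hz =>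
    ⟨invFunOn_mem hz, invFunOn_eq hz⟩
  have hL : LipschitzOnWith C (fun z => f (invFunOn h s z)) (h '' s) := by
    refine LipschitzOnWith.of_dist_le_mul fun z hz w hw => ?_
    have := hfh _ (hinv z hz).1 _ (hinv w hw).1
    rwa [(hinv z hz).2, (hinv w hw).2] at this
  have himg : f '' s ⊆ (fun z => f (invFunOn h s z)) '' (h '' s) := by
    rintro _ ⟨x, hx, rfl⟩
    refine ⟨h x, ⟨x, hx, rfl⟩, ?_⟩
    have h1 := hinv (h x) ⟨x, hx, rfl⟩
    have := hfh _ h1.1 _ hx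
    rw [h1.2, dist_self, mul_zero] at this
    exact dist_le_zero.1 this
  rw [euclideanHausdorffMeasure_def, euclideanHausdorffMeasure_def, Measure.smul_apply,
    Measure.smul_apply, nnreal_smul_coe_apply, nnreal_smul_coe_apply, mul_left_comm]
  gcongr
  calc μH[k] (f '' s) ≤ μH[k] ((fun z => f (invFunOn h s z)) '' (h '' s)) := measure_mono himg
    _ ≤ (C : ℝ≥0∞) ^ (k : ℝ) * μH[k] (h '' s) := hL.hausdorffMeasure_image_le k.cast_nonneg
    _ = _ := by rw [ENNReal.rpow_natCast]

/-- The parametrisation of the graph of `g`. -/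
def graphMap (g : E2 → ℝ) (y : E2) : P3 := WithLp.toLp 2 (y, g y)

/-- The surface element of a graph with differential `A`. -/
def graphJac (A : E2 →L[ℝ] ℝ) : ℝ := √(1 + ‖A‖ ^ 2)

theorem one_le_graphJac (A : E2 →L[ℝ] ℝ) : 1 ≤ graphJac A :=
  Real.one_le_sqrt.2 (by nlinarith [sq_nonneg ‖A‖])

theorem graphJac_sq (A : E2 →L[ℝ] ℝ) : graphJac A ^ 2 = 1 + ‖A‖ ^ 2 :=
  Real.sq_sqrt (by positivity)

theorem continuous_graphJac : Continuous graphJac := by unfold graphJac; fun_prop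

/-- √(1 + t²) is 1-Lipschitz and at least 1, so an additive error δ in the differential costs at
most a factor 1 + δ. -/
theorem graphJac_le_mul {A B : E2 →L[ℝ] ℝ} {δ : ℝ} (hδ : 0 ≤ δ) (h : ‖A - B‖ ≤ δ) :
    graphJac A ≤ (1 + δ) * graphJac B := by
  have hB := one_le_graphJac B
  have h2 : ‖A‖ ≤ ‖B‖ + δ := by
    have := norm_add_le (A - B) B
    rw [sub_add_cancel] at this
    linarith
  have h3 : ‖B‖ ≤ graphJac B := Real.le_sqrt_of_sq_le (by linarith)
  refine Real.sqrt_le_iff.2 ⟨by positivity, ?_⟩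
  have h4 := graphJac_sq B
  have h5 : graphJac B ≤ graphJac B ^ 2 := by nlinarith
  have h6 : ‖A‖ ^ 2 ≤ (‖B‖ + δ) ^ 2 := by gcongr
  nlinarith [mul_nonneg hδ (sub_nonneg.2 (h3.trans h5)),
    mul_nonneg (mul_nonneg hδ hδ) (sub_nonneg.2 (hB.trans h5))]

/-- The linear map parametrising the graph of the linear form `A`. -/
def graphLin (A : E2 →L[ℝ] ℝ) : E2 →ₗ[ℝ] P3 :=
  (WithLp.linearEquiv 2 ℝ (E2 × ℝ)).symm.toLinearMap ∘ₗ
    (LinearMap.id.prod (A : E2 →ₗ[ℝ] ℝ))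

theorem graphLin_apply (A : E2 →L[ℝ] ℝ) (v : E2) : graphLin A v = WithLp.toLp 2 (v, A v) := rfl

theorem norm_sq_eq_sum_single (A : E2 →L[ℝ] ℝ) :
    ‖A‖ ^ 2 = A (EuclideanSpace.single 0 1) ^ 2 + A (EuclideanSpace.single 1 1) ^ 2 := by
  have h : ∀ i, ((InnerProductSpace.toDual ℝ E2).symm A) i = A (EuclideanSpace.single i 1) := by
    intro i
    rw [← InnerProductSpace.toDual_symm_apply (x := EuclideanSpace.single i 1) (y := A),
      EuclideanSpace.inner_single_right]
    simp
  rw [← (InnerProductSpace.toDual ℝ E2).symm.norm_map A, EuclideanSpace.norm_sq_eq]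
  simp [Fin.sum_univ_two, h]

/-- The Gram matrix of the images of the two basis vectors is I + ∇A ∇Aᵀ, with determinant 1 + ‖A‖².
-/
theorem normDet_graphLin (A : E2 →L[ℝ] ℝ) : (graphLin A).normDet = graphJac A := by
  have h := (graphLin A).normDet_sq_eq_det_gram (EuclideanSpace.basisFun (Fin 2) ℝ)
  have h2 : (graphLin A).normDet ^ 2 = graphJac A ^ 2 := by
    rw [graphJac_sq, norm_sq_eq_sum_single]
    refine Eq.trans (by simpa using h) ?_
    simp [Matrix.det_fin_two, Matrix.gram, graphLin_apply, WithLp.prod_inner_apply,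
      EuclideanSpace.inner_single_left]
    ring
  exact (sq_eq_sq₀ (LinearMap.normDet_nonneg _) (by linarith [one_le_graphJac A])).1 h2

theorem measure_graphLin_image (A : E2 →L[ℝ] ℝ) (s : Set E2) :
    μHE[2] (graphLin A '' s) = ENNReal.ofReal (graphJac A) * volume s := by
  have := (graphLin A).euclideanHausdorffMeasure_image_eq_normDet_mul_volume s
  rwa [normDet_graphLin, finrank_euclideanSpace_fin] at this

theorem dist_le_dist_toLp (x y : E2) (a b : ℝ) :
    dist x y ≤ dist (WithLp.toLp 2 (x, a) : P3) (WithLp.toLp 2 (y, b)) := by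
  rw [WithLp.prod_dist_eq_of_L2]
  exact Real.le_sqrt_of_sq_le (by simp)

theorem dist_toLp_snd (x : E2) (a b : ℝ) :
    dist (WithLp.toLp 2 (x, a) : P3) (WithLp.toLp 2 (x, b)) = |a - b| := by
  rw [WithLp.prod_dist_eq_of_L2]
  simp [Real.dist_eq, Real.sqrt_sq_eq_abs]

/-- On a set where `g` is nearly linear, its graph is nearly isometric to a linear graph. -/
theorem dist_graphMap_graphLin {g : E2 → ℝ} {A : E2 →L[ℝ] ℝ} {x y : E2} {δ : ℝ}
    (h : |g x - g y - A (x - y)| ≤ δ * ‖x - y‖) (hδ : 0 ≤ δ) :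
    dist (graphMap g x) (graphMap g y) ≤ (1 + δ) * dist (graphLin A x) (graphLin A y) ∧
    dist (graphLin A x) (graphLin A y) ≤ (1 + δ) * dist (graphMap g x) (graphMap g y) := by
  have key : ‖(graphMap g x - graphMap g y) - (graphLin A x - graphLin A y)‖ ≤ δ * dist x y := by
    have e : (graphMap g x - graphMap g y) - (graphLin A x - graphLin A y)
        = (WithLp.toLp 2 (0, g x - g y - A (x - y)) : P3) := by
      simp only [graphMap, graphLin_apply, ← WithLp.toLp_sub, Prod.mk_sub_mk, map_sub, sub_self]
    rw [e, WithLp.prod_norm_eq_of_L2]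
    simpa [Real.sqrt_sq_eq_abs, dist_eq_norm] using h
  have h1 := dist_le_dist_toLp x y (g x) (g y)
  have h2 := dist_le_dist_toLp x y (A x) (A y)
  rw [← graphLin_apply, ← graphLin_apply] at h2
  change dist x y ≤ dist (graphMap g x) (graphMap g y) at h1
  constructor
  · have := norm_sub_norm_le (graphMap g x - graphMap g y) (graphLin A x - graphLin A y)
    simp only [dist_eq_norm] at *
    nlinarith
  · have := norm_sub_norm_le (graphLin A x - graphLin A y) (graphMap g x - graphMap g y)
    rw [norm_sub_rev (graphLin A x - graphLin A y)] at this
    simp only [dist_eq_norm] at *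
    nlinarith

theorem isClosedEmbedding_graphMap {g : E2 → ℝ} (hg : Continuous g) :
    Topology.IsClosedEmbedding (graphMap g) := by
  have hc : Continuous (graphMap g) :=
    (WithLp.prod_continuous_toLp 2 E2 ℝ).comp (continuous_id.prodMk hg)
  exact Function.LeftInverse.isClosedEmbedding (f := fun z : P3 => z.fst) (fun _ => rfl)
    (by fun_prop) hc

/-- Countably many pieces suffice for g to be δ-close to linear on each. The second bound says that
the linear model is also close to the true differential, almost everywhere on the piece. -/
theorem exists_partition_nearly_linear {g : E2 → ℝ} {s : Set E2} (hs : MeasurableSet s)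
    (hg : ∀ x ∈ s, DifferentiableAt ℝ g x) {δ : ℝ≥0} (hδ : δ ≠ 0) :
    ∃ (t : ℕ → Set E2) (A : ℕ → E2 →L[ℝ] ℝ), Pairwise (Disjoint on t) ∧
      (∀ n, MeasurableSet (t n)) ∧ s ⊆ ⋃ n, t n ∧
      (∀ n, ∀ x ∈ s ∩ t n, ∀ y ∈ s ∩ t n, |g x - g y - A n (x - y)| ≤ δ * ‖x - y‖) ∧
      (∀ n, ∀ᵐ x ∂(volume.restrict (s ∩ t n)), ‖fderiv ℝ g x - A n‖ ≤ δ) := by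
  -- `ApproximatesLinearOn.norm_fderiv_sub_le` concerns maps of a space into itself. The scalar g is
  -- therefore carried along a unit vector w and recovered by pairing with w.
  set w : E2 := EuclideanSpace.single 0 1 with hw
  have hw1 : ‖w‖ = 1 := by simp [hw]
  have hG : ∀ x ∈ s, HasFDerivWithinAt (fun x => g x • w) ((fderiv ℝ g x).smulRight w) s x :=
    fun x hx => ((hg x hx).hasFDerivAt.smul_const w).hasFDerivWithinAt
  obtain ⟨t, A, h1, h2, h3, h4, -⟩ := exists_partition_approximatesLinearOn_of_hasFDerivWithinAt
    (fun x => g x • w) s _ hG (fun _ => δ) (fun _ => hδ)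
  have hin : ∀ v : E2, |inner ℝ w v| ≤ ‖v‖ := fun v => by
    simpa [hw1] using abs_real_inner_le_norm w v
  refine ⟨t, fun n => (innerSL ℝ w).comp (A n), h1, h2, h3, fun n x hx y hy => ?_, fun n => ?_⟩
  · have h5 := (hin _).trans (h4 n x hx y hy)
    simpa [inner_sub_right, inner_smul_right, hw1] using h5
  · filter_upwards [(h4 n).norm_fderiv_sub_le volume (hs.inter (h2 n)) _
      fun x hx => (hG x hx.1).mono inter_subset_left] with x hx
    refine ContinuousLinearMap.opNorm_le_bound _ δ.2 fun v => ?_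
    have h5 := (hin _).trans (((fderiv ℝ g x).smulRight w - A n).le_of_opNorm_le hx v)
    simpa [inner_sub_right, inner_smul_right, hw1] using h5

/-- On each nearly linear piece the graph and its linear model are mutually (1+δ)-Lipschitz, which
costs (1+δ)² in area. Replacing the Jacobian of the model by the true one costs another 1+δ; hence
the cube. -/
theorem graph_measure_compare {g : E2 → ℝ} (hgc : Continuous g) {s : Set E2}
    (hs : MeasurableSet s) (hg : ∀ x ∈ s, DifferentiableAt ℝ g x) {δ : ℝ≥0} (hδ : δ ≠ 0) :
    μHE[2] (graphMap g '' s)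
        ≤ ((1 + δ : ℝ≥0) : ℝ≥0∞) ^ 3 * ∫⁻ x in s, ENNReal.ofReal (graphJac (fderiv ℝ g x)) ∧
    ∫⁻ x in s, ENNReal.ofReal (graphJac (fderiv ℝ g x))
        ≤ ((1 + δ : ℝ≥0) : ℝ≥0∞) ^ 3 * μHE[2] (graphMap g '' s) := by
  obtain ⟨t, A, t_disj, t_meas, t_cover, hA, hA'⟩ := exists_partition_nearly_linear hs hg hδ
  have hme := (isClosedEmbedding_graphMap hgc).measurableEmbedding
  have s_eq : s = ⋃ n, s ∩ t n := by
    rw [← inter_iUnion]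
    exact Subset.antisymm (subset_inter Subset.rfl t_cover) inter_subset_left
  have hm : ∀ n, MeasurableSet (s ∩ t n) := fun n => hs.inter (t_meas n)
  have hdis : Pairwise (Disjoint on fun n => s ∩ t n) :=
    pairwise_disjoint_mono t_disj fun n => inter_subset_right
  have e1 : μHE[2] (graphMap g '' s) = ∑' n, μHE[2] (graphMap g '' (s ∩ t n)) := by
    conv_lhs => rw [s_eq]
    rw [image_iUnion, measure_iUnion]
    · intro i j hij
      exact (disjoint_image_iff hme.injective).2 (hdis hij)
    · exact fun i => hme.measurableSet_image.2 (hm i)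
  have e2 : ∫⁻ x in s, ENNReal.ofReal (graphJac (fderiv ℝ g x))
      = ∑' n, ∫⁻ x in s ∩ t n, ENNReal.ofReal (graphJac (fderiv ℝ g x)) := by
    conv_lhs => rw [s_eq]
    rw [lintegral_iUnion hm hdis]
  have hC : ((1 + δ : ℝ≥0) : ℝ) = 1 + (δ : ℝ) := by simp
  have hCe : ((1 + δ : ℝ≥0) : ℝ≥0∞) = ENNReal.ofReal (1 + δ) := by
    rw [← hC, ENNReal.ofReal_coe_nnreal]
  have hδ0 : (0 : ℝ) ≤ 1 + δ := by positivity
  have hd := fun n x hx y hy => dist_graphMap_graphLin (hA n x hx y hy) δ.2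
  rw [e1, e2, ← ENNReal.tsum_mul_left, ← ENNReal.tsum_mul_left]
  constructor
  · refine ENNReal.tsum_le_tsum fun n => ?_
    have h1 : ENNReal.ofReal (graphJac (A n)) * volume (s ∩ t n)
        ≤ ((1 + δ : ℝ≥0) : ℝ≥0∞) *
          ∫⁻ x in s ∩ t n, ENNReal.ofReal (graphJac (fderiv ℝ g x)) := by
      rw [← lintegral_const_mul' _ _ ENNReal.coe_ne_top, ← setLIntegral_const]
      refine lintegral_mono_ae ?_
      filter_upwards [hA' n] with x hx
      rw [hCe, ← ENNReal.ofReal_mul hδ0]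
      rw [norm_sub_rev] at hx
      exact ENNReal.ofReal_le_ofReal (graphJac_le_mul δ.2 hx)
    have h2 := euclideanHausdorffMeasure_image_le_of_dist_le 2 (C := 1 + δ)
      (fun x hx y hy => by rw [hC]; exact (hd n x hx y hy).1)
    rw [measure_graphLin_image] at h2
    refine h2.trans ?_
    rw [pow_succ _ 2, mul_assoc]
    gcongr
  · refine ENNReal.tsum_le_tsum fun n => ?_
    have h1 : ∫⁻ x in s ∩ t n, ENNReal.ofReal (graphJac (fderiv ℝ g x))
        ≤ ((1 + δ : ℝ≥0) : ℝ≥0∞) * (ENNReal.ofReal (graphJac (A n)) * volume (s ∩ t n)) := by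
      rw [← setLIntegral_const, ← lintegral_const_mul' _ _ ENNReal.coe_ne_top]
      refine lintegral_mono_ae ?_
      filter_upwards [hA' n] with x hx
      rw [hCe, ← ENNReal.ofReal_mul hδ0]
      exact ENNReal.ofReal_le_ofReal (graphJac_le_mul δ.2 hx)
    have h2 := euclideanHausdorffMeasure_image_le_of_dist_le 2 (C := 1 + δ)
      (fun x hx y hy => by rw [hC]; exact (hd n x hx y hy).2)
    rw [measure_graphLin_image] at h2
    refine h1.trans ?_
    rw [pow_succ' _ 2, mul_assoc]
    gcongr

theorem le_of_forall_one_add_pow_mul_le {a b : ℝ≥0∞}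
    (h : ∀ δ : ℝ≥0, δ ≠ 0 → a ≤ ((1 + δ : ℝ≥0) : ℝ≥0∞) ^ 3 * b) : a ≤ b := by
  have h1 : Tendsto (fun δ : ℝ≥0 => ((1 + δ : ℝ≥0) : ℝ≥0∞) ^ 3 * b) (𝓝[≠] 0) (𝓝 (1 * b)) := by
    refine ENNReal.Tendsto.mul_const ?_ (Or.inl one_ne_zero)
    have : Continuous fun δ : ℝ≥0 => (((1 + δ) ^ 3 : ℝ≥0) : ℝ≥0∞) :=
      ENNReal.continuous_coe.comp (by fun_prop)
    simpa using (this.tendsto 0).mono_left (nhdsWithin_le_nhds (s := {0}ᶜ))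
  rw [one_mul] at h1
  exact ge_of_tendsto h1 (eventually_mem_nhdsWithin.mono fun δ hδ => h δ hδ)

theorem lipschitzWith_graphMap {g : E2 → ℝ} {K : ℝ≥0} (hg : LipschitzWith K g) :
    LipschitzWith (1 + K) (graphMap g) := by
  refine LipschitzWith.of_dist_le_mul fun x y => ?_
  have h1 := dist_triangle (WithLp.toLp 2 (x, g x) : P3) (WithLp.toLp 2 (y, g x))
    (WithLp.toLp 2 (y, g y))
  rw [dist_toLp_snd] at h1
  have h2 := hg.dist_le_mul x y
  have h3 : dist (WithLp.toLp 2 (x, g x) : P3) (WithLp.toLp 2 (y, g x)) = dist x y := by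
    rw [WithLp.prod_dist_eq_of_L2]
    simp
  rw [Real.dist_eq] at h2
  rw [NNReal.coe_add, NNReal.coe_one, graphMap, graphMap]
  linarith

/-- **Area formula** for a Lipschitz graph: the surface measure of the part over `s`. -/
theorem measure_graphMap_image {g : E2 → ℝ} {K : ℝ≥0} (hg : LipschitzWith K g) {s : Set E2}
    (hs : MeasurableSet s) :
    μHE[2] (graphMap g '' s) = ∫⁻ x in s, ENNReal.ofReal (graphJac (fderiv ℝ g x)) := by
  -- Rademacher's theorem. The part of the graph over this null set is itself null, being a
  -- Lipschitz image.
  have hN : volume {x | ¬ DifferentiableAt ℝ g x} = 0 := hg.ae_differentiableAt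
  have hDm : MeasurableSet {x | DifferentiableAt ℝ g x} := measurableSet_of_differentiableAt ℝ g
  have hN' : μHE[2] (graphMap g '' {x | ¬ DifferentiableAt ℝ g x}) = 0 := by
    have h := euclideanHausdorffMeasure_image_le_of_dist_le (f := graphMap g) (h := id)
      (s := {x | ¬ DifferentiableAt ℝ g x}) 2 fun x _ y _ =>
        (lipschitzWith_graphMap hg).dist_le_mul x y
    rw [image_id, EuclideanSpace.euclideanHausdorffMeasure_eq_volume, hN, mul_zero] at h
    exact nonpos_iff_eq_zero.1 h
  have hsm : MeasurableSet (s ∩ {x | DifferentiableAt ℝ g x}) := hs.inter hDm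
  have e1 : μHE[2] (graphMap g '' s)
      = μHE[2] (graphMap g '' (s ∩ {x | DifferentiableAt ℝ g x})) := by
    refine le_antisymm ?_ (measure_mono (image_mono inter_subset_left))
    calc μHE[2] (graphMap g '' s)
        ≤ μHE[2] (graphMap g '' (s ∩ {x | DifferentiableAt ℝ g x})
            ∪ graphMap g '' {x | ¬ DifferentiableAt ℝ g x}) := by
          refine measure_mono ?_
          rw [← image_union]
          refine image_mono fun x hx => ?_
          by_cases h : DifferentiableAt ℝ g x
          · exact Or.inl ⟨hx, h⟩
          · exact Or.inr h
      _ ≤ _ := measure_union_le _ _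
      _ = _ := by rw [hN', add_zero]
  have e2 : ∫⁻ x in s, ENNReal.ofReal (graphJac (fderiv ℝ g x))
      = ∫⁻ x in s ∩ {x | DifferentiableAt ℝ g x}, ENNReal.ofReal (graphJac (fderiv ℝ g x)) := by
    rw [← Measure.restrict_inter_add_sdiff s hDm (μ := volume), lintegral_add_measure]
    have : volume (s \ {x | DifferentiableAt ℝ g x}) = 0 :=
      measure_mono_null (fun x hx => hx.2) hN
    rw [Measure.restrict_eq_zero.2 this]
    simp
  rw [e1, e2]
  exact le_antisymm
    (le_of_forall_one_add_pow_mul_le fun δ hδ =>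
      (graph_measure_compare hg.continuous hsm (fun x hx => hx.2) hδ).1)
    (le_of_forall_one_add_pow_mul_le fun δ hδ =>
      (graph_measure_compare hg.continuous hsm (fun x hx => hx.2) hδ).2)

end

section

open MeasureTheory Measure Set Filter Function
open scoped NNReal ENNReal

/-! ### Outward normals -/

theorem IsOutwardNormal.eventually_mem {A : Set E3} {x n w : E3} (h : IsOutwardNormal A x n)
    (hw : inner ℝ n w < 0) : ∀ᶠ t : ℝ in 𝓝[>] 0, x + t • w ∈ A := by
  have hw0 : 0 < ‖w‖ := norm_pos_iff.2 fun h0 => by simp [h0] at hw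
  have hc : Tendsto (fun t : ℝ => x + t • w) (𝓝[>] 0) (𝓝 x) := by
    have : Continuous fun t : ℝ => x + t • w := by fun_prop
    simpa using (this.tendsto 0).mono_left nhdsWithin_le_nhds
  -- The opening is half the cosine between w and -n, so the whole ray lies strictly inside the
  -- cone.
  have hε : 0 < -inner ℝ n w / (2 * ‖w‖) := div_pos (neg_pos.2 hw) (by positivity)
  filter_upwards [hc.eventually (h.2.2 _ hε), self_mem_nhdsWithin] with t ht ht0
  have ht0 : 0 < t := ht0
  apply ht.1
  rw [add_sub_cancel_left, inner_smul_right, norm_smul, Real.norm_of_nonneg ht0.le]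
  field_simp
  linarith

theorem IsOutwardNormal.eventually_notMem {A : Set E3} {x n w : E3} (h : IsOutwardNormal A x n)
    (hw : 0 < inner ℝ n w) : ∀ᶠ t : ℝ in 𝓝[>] 0, x + t • w ∉ A := by
  have hw0 : 0 < ‖w‖ := norm_pos_iff.2 fun h0 => by simp [h0] at hw
  have hc : Tendsto (fun t : ℝ => x + t • w) (𝓝[>] 0) (𝓝 x) := by
    have : Continuous fun t : ℝ => x + t • w := by fun_prop
    simpa using (this.tendsto 0).mono_left nhdsWithin_le_nhds
  have hε : 0 < inner ℝ n w / (2 * ‖w‖) := by positivity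
  filter_upwards [hc.eventually (h.2.2 _ hε), self_mem_nhdsWithin] with t ht ht0
  have ht0 : 0 < t := ht0
  apply ht.2
  rw [add_sub_cancel_left, inner_smul_right, norm_smul, Real.norm_of_nonneg ht0.le]
  field_simp
  linarith

theorem inner_lt_one_of_ne {n m : E3} (hn : ‖n‖ = 1) (hm : ‖m‖ = 1) (h : n ≠ m) :
    inner ℝ n m < 1 :=
  lt_of_le_of_ne (by simpa [hn, hm] using real_inner_le_norm n m)
    fun h1 => h ((inner_eq_one_iff_of_norm_eq_one hn hm).1 h1)

/-- If n ≠ m, the direction m - n points into A and out of B, contradicting A ⊆ B. -/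
theorem IsOutwardNormal.eq_of_subset {A B : Set E3} {x n m : E3} (hA : IsOutwardNormal A x n)
    (hB : IsOutwardNormal B x m) (hAB : A ⊆ B) : n = m := by
  by_contra hne
  have h := inner_lt_one_of_ne hA.2.1 hB.2.1 hne
  have h1 : inner ℝ n (m - n) < 0 := by
    rw [inner_sub_right, real_inner_self_eq_norm_sq, hA.2.1]; linarith
  have h2 : 0 < inner ℝ m (m - n) := by
    rw [inner_sub_right, real_inner_self_eq_norm_sq, hB.2.1, real_inner_comm]; linarith
  obtain ⟨t, ht1, ht2⟩ := ((hA.eventually_mem h1).and (hB.eventually_notMem h2)).exists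
  exact ht2 (hAB ht1)

/-- If m ≠ -n, the direction -(n + m) points into both sets. -/
theorem IsOutwardNormal.eq_neg_of_disjoint {A B : Set E3} {x n m : E3}
    (hA : IsOutwardNormal A x n) (hB : IsOutwardNormal B x m) (hAB : Disjoint A B) :
    m = -n := by
  by_contra hne
  have h := inner_lt_one_of_ne hB.2.1 (by rw [norm_neg]; exact hA.2.1) hne
  rw [inner_neg_right] at h
  have h1 : inner ℝ n (-(n + m)) < 0 := by
    rw [inner_neg_right, inner_add_right, real_inner_self_eq_norm_sq, hA.2.1, real_inner_comm]
    linarith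
  have h2 : inner ℝ m (-(n + m)) < 0 := by
    rw [inner_neg_right, inner_add_right, real_inner_self_eq_norm_sq, hB.2.1]
    linarith
  obtain ⟨t, ht1, ht2⟩ := ((hA.eventually_mem h1).and (hB.eventually_mem h2)).exists
  exact disjoint_left.1 hAB ht1 ht2

theorem IsOutwardNormal.outwardNormal_eq {A : Set E3} {x n : E3} (h : IsOutwardNormal A x n) :
    outwardNormal A x = n := by
  have hex : ∃ n, IsOutwardNormal A x n := ⟨n, h⟩
  rw [outwardNormal, dif_pos hex]
  exact hex.choose_spec.eq_of_subset h Subset.rfl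

theorem norm_outwardNormal_le (A : Set E3) (x : E3) : ‖outwardNormal A x‖ ≤ 1 := by
  by_cases h : ∃ n, IsOutwardNormal A x n
  · obtain ⟨n, hn⟩ := h
    rw [hn.outwardNormal_eq, hn.2.1]
  · rw [outwardNormal, dif_neg h]
    simp

/-! ### Graph charts -/

/-- In the open set `U`, and in the Cartesian coordinates `e`, the set `A` is the part below the
graph of the Lipschitz function `g`. -/
structure IsGraphChart (A U : Set E3) (e : E3 ≃ₗᵢ[ℝ] P3) (g : E2 → ℝ) (K : ℝ≥0) : Prop where
  isOpen : IsOpen U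
  lipschitz : LipschitzWith K g
  mem_iff : ∀ y ∈ U, (y ∈ A ↔ (e y).snd < g (e y).fst)

/-- The parametrisation of the boundary in a graph chart. -/
def graphPoint (e : E3 ≃ₗᵢ[ℝ] P3) (g : E2 → ℝ) (y : E2) : E3 := e.symm (graphMap g y)

/-- The unnormalised outward conormal in a graph chart, as a function of the direction `v`. -/
def graphConormal (e : E3 ≃ₗᵢ[ℝ] P3) (g : E2 → ℝ) (y : E2) (v : E3) : ℝ :=
  (e v).snd - fderiv ℝ g y (e v).fst

/-- The outward unit normal in a graph chart. -/
def graphNormal (e : E3 ≃ₗᵢ[ℝ] P3) (g : E2 → ℝ) (y : E2) : E3 :=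
  (graphJac (fderiv ℝ g y))⁻¹ • e.symm
    (WithLp.toLp 2 (-(InnerProductSpace.toDual ℝ E2).symm (fderiv ℝ g y), (1 : ℝ)))

variable {e : E3 ≃ₗᵢ[ℝ] P3} {g : E2 → ℝ} {K : ℝ≥0} {A U : Set E3}

theorem apply_graphPoint (y : E2) : e (graphPoint e g y) = graphMap g y := by simp [graphPoint]

theorem continuous_graphPoint (hg : Continuous g) : Continuous (graphPoint e g) :=
  e.symm.continuous.comp (isClosedEmbedding_graphMap hg).continuous

theorem isClosedEmbedding_graphPoint (hg : Continuous g) :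
    Topology.IsClosedEmbedding (graphPoint e g) :=
  e.symm.toHomeomorph.isClosedEmbedding.comp (isClosedEmbedding_graphMap hg)

theorem norm_fst_le_norm (z : P3) : ‖z.fst‖ ≤ ‖z‖ := by
  rw [WithLp.prod_norm_eq_of_L2]
  exact Real.le_sqrt_of_sq_le (by linarith [sq_nonneg ‖z.snd‖])

theorem norm_snd_le_norm (z : P3) : ‖z.snd‖ ≤ ‖z‖ := by
  rw [WithLp.prod_norm_eq_of_L2]
  exact Real.le_sqrt_of_sq_le (by linarith [sq_nonneg ‖z.fst‖])

theorem mem_range_graphPoint {x : E3} :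
    x ∈ range (graphPoint e g) ↔ (e x).snd = g (e x).fst := by
  constructor
  · rintro ⟨y, rfl⟩
    rw [apply_graphPoint]
    rfl
  · intro h
    refine ⟨(e x).fst, e.injective ?_⟩
    rw [apply_graphPoint, graphMap, ← h]
    rfl

theorem measurable_fderiv_jac : Measurable fun y => graphJac (fderiv ℝ g y) :=
  continuous_graphJac.measurable.comp (measurable_fderiv ℝ g)

/-- The area formula as an identity of measures; null sets, measurability and integrals on the graph
then pull back to the plane. -/
theorem map_graphPoint (hg : LipschitzWith K g) :
    (volume.withDensity fun y => ENNReal.ofReal (graphJac (fderiv ℝ g y))).map (graphPoint e g)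
      = μHE[2].restrict (range (graphPoint e g)) := by
  have hme := (isClosedEmbedding_graphPoint (e := e) hg.continuous).measurableEmbedding
  refine Measure.ext fun s hs => ?_
  rw [hme.map_apply, Measure.restrict_apply hs, withDensity_apply _ (hme.measurable hs),
    ← measure_graphMap_image hg (hme.measurable hs),
    ← (e.symm.isometry).euclideanHausdorffMeasure_image, ← image_preimage_eq_inter_range,
    image_image]
  rfl

theorem norm_fderiv_le (hg : LipschitzWith K g) (y : E2) : ‖fderiv ℝ g y‖ ≤ K :=
  norm_fderiv_le_of_lipschitz ℝ hg

theorem graphJac_le (hg : LipschitzWith K g) (y : E2) : graphJac (fderiv ℝ g y) ≤ 1 + K := by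
  have h := norm_fderiv_le hg y
  refine Real.sqrt_le_iff.2 ⟨by positivity, ?_⟩
  nlinarith [norm_nonneg (fderiv ℝ g y), K.2, pow_le_pow_left₀ (norm_nonneg (fderiv ℝ g y)) h 2]

theorem ae_restrict_range_graphPoint (hg : LipschitzWith K g) {p : E3 → Prop}
    (h : ∀ᵐ y : E2, p (graphPoint e g y)) :
    ∀ᵐ x ∂(μHE[2].restrict (range (graphPoint e g))), p x := by
  have hme := (isClosedEmbedding_graphPoint (e := e) hg.continuous).measurableEmbedding
  rw [← map_graphPoint hg, hme.ae_map_iff]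
  exact (withDensity_absolutelyContinuous _ _).ae_le h

theorem aestronglyMeasurable_range_graphPoint (hg : LipschitzWith K g) {H : E3 → ℝ}
    (h : AEStronglyMeasurable (fun y => H (graphPoint e g y)) volume) :
    AEStronglyMeasurable H (μHE[2].restrict (range (graphPoint e g))) := by
  have hme := (isClosedEmbedding_graphPoint (e := e) hg.continuous).measurableEmbedding
  rw [← map_graphPoint hg, hme.aestronglyMeasurable_map_iff]
  exact h.mono_ac (withDensity_absolutelyContinuous _ _)

theorem integral_range_graphPoint (hg : LipschitzWith K g) (H : E3 → ℝ) :
    ∫ x in range (graphPoint e g), H x ∂μHE[2]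
      = ∫ y, graphJac (fderiv ℝ g y) * H (graphPoint e g y) := by
  have hme := (isClosedEmbedding_graphPoint (e := e) hg.continuous).measurableEmbedding
  rw [← map_graphPoint hg, hme.integral_map,
    integral_withDensity_eq_integral_toReal_smul measurable_fderiv_jac.ennreal_ofReal
      (ae_of_all _ fun _ => ENNReal.ofReal_lt_top)]
  refine integral_congr_ae (ae_of_all _ fun y => ?_)
  simp only [smul_eq_mul]
  rw [ENNReal.toReal_ofReal (by linarith [one_le_graphJac (fderiv ℝ g y)])]

theorem measure_range_graphPoint_inter_lt_top (hg : LipschitzWith K g) {B : Set E3}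
    (hB : Bornology.IsBounded B) : μHE[2] (range (graphPoint e g) ∩ B) < ∞ := by
  have hme := (isClosedEmbedding_graphPoint (e := e) hg.continuous).measurableEmbedding
  have hcl : MeasurableSet (closure B) := isClosed_closure.measurableSet
  have hb : Bornology.IsBounded (graphPoint e g ⁻¹' closure B) := by
    have h1 : graphPoint e g ⁻¹' closure B ⊆ (fun x : E3 => (e x).fst) '' closure B := fun y hy =>
      ⟨graphPoint e g y, hy, by simp only [apply_graphPoint]; rfl⟩
    have h2 : IsCompact (closure B) := hB.isCompact_closure
    exact ((h2.image (by fun_prop : Continuous fun x : E3 => (e x).fst)).isBounded).subset h1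
  calc μHE[2] (range (graphPoint e g) ∩ B)
      ≤ μHE[2] (closure B ∩ range (graphPoint e g)) :=
        measure_mono fun x hx => ⟨subset_closure hx.2, hx.1⟩
    _ = ∫⁻ y in graphPoint e g ⁻¹' closure B, ENNReal.ofReal (graphJac (fderiv ℝ g y)) := by
        rw [← Measure.restrict_apply hcl, ← map_graphPoint hg, hme.map_apply,
          withDensity_apply _ (hme.measurable hcl)]
    _ ≤ ∫⁻ _ in graphPoint e g ⁻¹' closure B, ENNReal.ofReal (1 + K) :=
        lintegral_mono fun y => ENNReal.ofReal_le_ofReal (graphJac_le hg y)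
    _ = ENNReal.ofReal (1 + K) * volume (graphPoint e g ⁻¹' closure B) := setLIntegral_const _ _
    _ < ∞ := ENNReal.mul_lt_top ENNReal.ofReal_lt_top hb.measure_lt_top

/-- The Jacobian of the surface measure cancels the normalisation of the normal, so flux integrals
over a graph become plane integrals against the conormal. -/
theorem inner_graphNormal (y : E2) (v : E3) :
    graphJac (fderiv ℝ g y) * inner ℝ (graphNormal e g y) v = graphConormal e g y v := by
  have hJ : graphJac (fderiv ℝ g y) ≠ 0 := by linarith [one_le_graphJac (fderiv ℝ g y)]
  rw [graphNormal, real_inner_smul_left, mul_inv_cancel_left₀ hJ,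
    LinearIsometryEquiv.inner_map_eq_flip, LinearIsometryEquiv.symm_symm,
    WithLp.prod_inner_apply]
  simp [graphConormal]
  ring

theorem norm_graphNormal (y : E2) : ‖graphNormal e g y‖ = 1 := by
  have hJ : 0 < graphJac (fderiv ℝ g y) := by linarith [one_le_graphJac (fderiv ℝ g y)]
  have h : ‖(WithLp.toLp 2 (-(InnerProductSpace.toDual ℝ E2).symm (fderiv ℝ g y), (1 : ℝ)) : P3)‖
      = graphJac (fderiv ℝ g y) := by
    rw [WithLp.prod_norm_eq_of_L2, graphJac]
    simp [add_comm]
  rw [graphNormal, norm_smul, LinearIsometryEquiv.norm_map, h, norm_inv,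
    Real.norm_of_nonneg hJ.le, inv_mul_cancel₀ hJ.ne']

/-- The height above the graph, in the coordinates `e`. -/
def graphHeight (e : E3 ≃ₗᵢ[ℝ] P3) (g : E2 → ℝ) (x : E3) : ℝ := (e x).snd - g (e x).fst

theorem continuous_graphHeight (hg : Continuous g) : Continuous (graphHeight e g) := by
  unfold graphHeight; fun_prop

/-- The upward unit vector of the coordinates `e`. -/
def graphUp (e : E3 ≃ₗᵢ[ℝ] P3) : E3 := e.symm (WithLp.toLp 2 (0, (1 : ℝ)))

theorem graphHeight_add_up (x : E3) (t : ℝ) :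
    graphHeight e g (x + t • graphUp e) = graphHeight e g x + t := by
  simp [graphHeight, graphUp]
  ring

theorem IsGraphChart.mem_iff' (h : IsGraphChart A U e g K) {x : E3} (hx : x ∈ U) :
    x ∈ A ↔ graphHeight e g x < 0 := by rw [h.mem_iff x hx, graphHeight, sub_neg]

theorem IsGraphChart.mem_closure_iff (h : IsGraphChart A U e g K) {x : E3} (hx : x ∈ U) :
    x ∈ closure A ↔ graphHeight e g x ≤ 0 := by
  have hc := continuous_graphHeight (e := e) h.lipschitz.continuous
  constructor
  · intro hcl
    by_contra! hpos
    obtain ⟨z, ⟨hz1, hz2⟩, hz3⟩ := mem_closure_iff_nhds.1 hcl _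
      (inter_mem (h.isOpen.mem_nhds hx) ((isOpen_lt continuous_const hc).mem_nhds hpos))
    have := (h.mem_iff' hz1).1 hz3
    have hz2 : 0 < graphHeight e g z := hz2
    linarith
  · intro hle
    have ht : Tendsto (fun t : ℝ => x + t • graphUp e) (𝓝[<] 0) (𝓝 x) := by
      have : Continuous fun t : ℝ => x + t • graphUp e := by fun_prop
      simpa using (this.tendsto 0).mono_left nhdsWithin_le_nhds
    refine mem_closure_of_tendsto ht ?_
    filter_upwards [ht.eventually (h.isOpen.mem_nhds hx), self_mem_nhdsWithin] with t ht1 ht2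
    have ht2 : t < 0 := ht2
    rw [h.mem_iff' ht1, graphHeight_add_up]
    linarith

theorem IsGraphChart.mem_frontier_iff (h : IsGraphChart A U e g K) (hA : IsOpen A) {x : E3}
    (hx : x ∈ U) : x ∈ frontier A ↔ x ∈ range (graphPoint e g) := by
  rw [hA.frontier_eq, Set.mem_sdiff, h.mem_closure_iff hx, h.mem_iff' hx, mem_range_graphPoint,
    graphHeight]
  constructor
  · rintro ⟨h1, h2⟩; linarith
  · intro h1; constructor <;> linarith

/-- Differentiability of g makes the height of x above the graph equal to J⟨n, w⟩ up to ε‖w‖, where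
w is the displacement from the boundary point and J the Jacobian. Since J ≥ 1, that error cannot
change the sign outside the cone of opening ε. -/
theorem IsGraphChart.isOutwardNormal (h : IsGraphChart A U e g K) (hA : IsOpen A) {y : E2}
    (hy : graphPoint e g y ∈ U) (hd : DifferentiableAt ℝ g y) :
    IsOutwardNormal A (graphPoint e g y) (graphNormal e g y) := by
  refine ⟨(h.mem_frontier_iff hA hy).2 ⟨y, rfl⟩, norm_graphNormal y, fun ε hε => ?_⟩
  have hJ := one_le_graphJac (fderiv ℝ g y)
  have ho := hd.hasFDerivAt.isLittleO.bound hε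
  have ht : Tendsto (fun x : E3 => (e x).fst) (𝓝 (graphPoint e g y)) (𝓝 y) := by
    have : Continuous fun x : E3 => (e x).fst := by fun_prop
    have h1 := this.tendsto (graphPoint e g y)
    rwa [apply_graphPoint] at h1
  filter_upwards [ht.eventually ho, h.isOpen.mem_nhds hy] with x hx hxU
  set w := x - graphPoint e g y with hw
  have hew : e w = e x - graphMap g y := by rw [hw, map_sub, apply_graphPoint]
  have hw1 : (e w).fst = (e x).fst - y := by rw [hew]; rfl
  have hw2 : (e w).snd = (e x).snd - g y := by rw [hew]; rfl
  have hn := inner_graphNormal (e := e) (g := g) y w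
  rw [graphConormal, hw1, hw2] at hn
  have hle : ‖(e x).fst - y‖ ≤ ‖w‖ := by
    rw [← hw1, ← e.norm_map w]
    exact norm_fst_le_norm _
  have hx' := (abs_le.1 (hx.trans (mul_le_mul_of_nonneg_left hle hε.le)))
  have hεw : 0 ≤ ε * ‖w‖ := by positivity
  rw [h.mem_iff' hxU, graphHeight]
  constructor
  · intro hi
    have : graphJac (fderiv ℝ g y) * inner ℝ (graphNormal e g y) w
        < graphJac (fderiv ℝ g y) * -(ε * ‖w‖) := by gcongr
    nlinarith
  · intro hi
    have : graphJac (fderiv ℝ g y) * (ε * ‖w‖)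
        < graphJac (fderiv ℝ g y) * inner ℝ (graphNormal e g y) w := by gcongr
    nlinarith

theorem IsGraphChart.jac_mul_outwardNormal (h : IsGraphChart A U e g K) (hA : IsOpen A) :
    ∀ᵐ y : E2, graphPoint e g y ∈ U → ∀ η, graphJac (fderiv ℝ g y)
      * outwardNormal A (graphPoint e g y) η = graphConormal e g y (EuclideanSpace.single η 1) := by
  filter_upwards [h.lipschitz.ae_differentiableAt] with y hy hyU η
  rw [(h.isOutwardNormal hA hyU hy).outwardNormal_eq, ← inner_graphNormal,
    EuclideanSpace.inner_single_right]
  simp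

theorem measurable_graphConormal (v : E3) : Measurable fun y => graphConormal e g y v := by
  unfold graphConormal
  exact measurable_const.sub (measurable_fderiv_apply_const ℝ g _)

theorem abs_graphConormal_le (hg : LipschitzWith K g) (y : E2) (v : E3) :
    |graphConormal e g y v| ≤ (1 + K) * ‖v‖ := by
  have h1 : ‖(e v).fst‖ ≤ ‖v‖ := (norm_fst_le_norm _).trans_eq (e.norm_map v)
  have h2 : ‖(e v).snd‖ ≤ ‖v‖ := (norm_snd_le_norm _).trans_eq (e.norm_map v)
  have h3 := (fderiv ℝ g y).le_of_opNorm_le (norm_fderiv_le hg y) (e v).fst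
  have h4 : (K : ℝ) * ‖(e v).fst‖ ≤ K * ‖v‖ := by gcongr
  rw [graphConormal, ← Real.norm_eq_abs]
  exact (norm_sub_le _ _).trans (by linarith)

end

section

open MeasureTheory Measure Set Filter Function
open scoped NNReal ENNReal

/-! ### The divergence theorem below a Lipschitz graph, for smooth functions -/

variable {e : E3 ≃ₗᵢ[ℝ] P3} {g : E2 → ℝ} {K : ℝ≥0}

/-- Coordinates flattening the graph of `g`: base point and height above the graph. -/
def graphShear (e : E3 ≃ₗᵢ[ℝ] P3) (g : E2 → ℝ) (p : E2 × ℝ) : E3 :=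
  e.symm (WithLp.toLp 2 (p.1, g p.1 + p.2))

theorem graphShear_eq_graphPoint (y : E2) (z : ℝ) :
    graphShear e g (y, z) = graphPoint e (fun y => g y + z) y := rfl

theorem graphShear_zero (y : E2) : graphShear e g (y, 0) = graphPoint e g y := by
  simp [graphShear, graphPoint, graphMap]

theorem graphHeight_graphShear (p : E2 × ℝ) : graphHeight e g (graphShear e g p) = p.2 := by
  simp [graphHeight, graphShear]

theorem graphShear_eq_add (y : E2) (z : ℝ) :
    graphShear e g (y, z) = graphPoint e g y + z • graphUp e := by
  apply e.injective
  rw [map_add, map_smul, apply_graphPoint]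
  simp [graphShear, graphUp, graphMap, ← WithLp.toLp_smul, ← WithLp.toLp_add]

theorem continuous_graphShear (hg : Continuous g) : Continuous (graphShear e g) := by
  refine e.symm.continuous.comp ((WithLp.prod_continuous_toLp 2 E2 ℝ).comp ?_)
  fun_prop

theorem isClosedEmbedding_graphShear (hg : Continuous g) :
    Topology.IsClosedEmbedding (graphShear e g) :=
  Function.LeftInverse.isClosedEmbedding (f := fun x : E3 => ((e x).fst, graphHeight e g x))
    (fun p => Prod.ext (by simp [graphShear]) (graphHeight_graphShear p))
    ((by fun_prop : Continuous fun x : E3 => (e x).fst).prodMk (continuous_graphHeight hg))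
    (continuous_graphShear hg)

/-- On each vertical fibre the shear is a translation. -/
theorem measurePreserving_graphShear (hg : Continuous g) :
    MeasurePreserving (graphShear e g) (volume.prod volume) volume := by
  have h1 : MeasurePreserving (fun p : E2 × ℝ => (id p.1, g p.1 + p.2))
      (volume.prod volume) (volume.prod volume) :=
    (MeasurePreserving.id _).skew_product (g := fun a b => g a + b) (by fun_prop)
      (ae_of_all _ fun a => map_add_left_eq_self _ _)
  exact e.symm.measurePreserving.comp ((WithLp.volume_preserving_toLp E2 ℝ).comp h1)

theorem lipschitzWith_graphPoint (hg : LipschitzWith K g) :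
    LipschitzWith (1 + K) (graphPoint e g) := by
  have := e.symm.lipschitz.comp (lipschitzWith_graphMap hg)
  rwa [one_mul] at this

theorem hasLineDerivAt_graphPoint {y : E2} (hd : DifferentiableAt ℝ g y) (w : E2) :
    HasLineDerivAt ℝ (graphPoint e g) (e.symm (WithLp.toLp 2 (w, fderiv ℝ g y w))) y w := by
  have h1 : HasFDerivAt (fun y => (y, g y)) ((ContinuousLinearMap.id ℝ E2).prod (fderiv ℝ g y)) y :=
    (hasFDerivAt_id y).prodMk hd.hasFDerivAt
  have h2 := (((e.symm.toContinuousLinearEquiv : P3 →L[ℝ] E3).comp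
    ((WithLp.prodContinuousLinearEquiv 2 ℝ E2 ℝ).symm : E2 × ℝ →L[ℝ] P3)).hasFDerivAt.comp y h1)
  exact h2.hasLineDerivAt w

/-- **Divergence theorem below a Lipschitz graph**, for a smooth function with compact support. -/
theorem integral_fderiv_below_graph (hg : LipschitzWith K g) {φ : E3 → ℝ} (hφ : ContDiff ℝ 1 φ)
    (hφc : HasCompactSupport φ) (v : E3) :
    ∫ x in {x | graphHeight e g x < 0}, fderiv ℝ φ x v
      = ∫ y, graphConormal e g y v * φ (graphPoint e g y) := by
  have hDc : ∀ w, Continuous fun x => fderiv ℝ φ x w := fun w =>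
    (hφ.continuous_fderiv one_ne_zero).clm_apply continuous_const
  have hDs : ∀ w, HasCompactSupport fun x => fderiv ℝ φ x w := fun w => hφc.fderiv_apply (𝕜 := ℝ) w
  have hce := isClosedEmbedding_graphShear (e := e) hg.continuous
  have hDi : ∀ w, Integrable (fun p => fderiv ℝ φ (graphShear e g p) w)
      ((volume : Measure E2).prod (volume.restrict (Iio (0 : ℝ)))) := fun w => by
    have : Integrable (fun p => fderiv ℝ φ (graphShear e g p) w)
        ((volume : Measure E2).prod (volume : Measure ℝ)) :=
      ((hDc w).comp hce.continuous).integrable_of_hasCompactSupport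
        ((hDs w).comp_isClosedEmbedding hce)
    have h2 := this.restrict (s := univ ×ˢ Iio (0 : ℝ))
    rwa [← Measure.prod_restrict, Measure.restrict_univ] at h2
  have hCi : Integrable (fun p : E2 × ℝ => graphConormal e g p.1 v *
      fderiv ℝ φ (graphShear e g p) (graphUp e))
      ((volume : Measure E2).prod (volume.restrict (Iio (0 : ℝ)))) :=
    (hDi _).bdd_mul (c := (1 + K) * ‖v‖)
      ((measurable_graphConormal v).comp measurable_fst).aestronglyMeasurable
      (ae_of_all _ fun p => abs_graphConormal_le hg p.1 v)
  have hset : graphShear e g ⁻¹' {x | graphHeight e g x < 0} = univ ×ˢ Iio (0 : ℝ) := by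
    ext p
    simp [graphHeight_graphShear]
  have hmeas : MeasurableSet {x | graphHeight e g x < 0} :=
    (isOpen_lt (continuous_graphHeight hg.continuous) continuous_const).measurableSet
  rw [← (measurePreserving_graphShear (e := e) hg.continuous).map_eq,
    setIntegral_map hmeas (hDc v).aestronglyMeasurable hce.continuous.aemeasurable, hset,
    ← Measure.prod_restrict, Measure.restrict_univ]
  -- The vector v minus its conormal times the upward direction is tangent to the graph. On each
  -- level z the integrand is therefore a directional derivative, in the plane, of φ along the
  -- translated graph, and its integral vanishes.
  have hzero : ∫ p, (fderiv ℝ φ (graphShear e g p) v - graphConormal e g p.1 v *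
      fderiv ℝ φ (graphShear e g p) (graphUp e))
      ∂((volume : Measure E2).prod (volume.restrict (Iio (0 : ℝ)))) = 0 := by
    refine (integral_prod_symm _ ((hDi v).sub hCi)).trans ?_
    refine integral_eq_zero_of_ae (ae_of_all _ fun z => ?_)
    have hgz : LipschitzWith K fun y => g y + z := by
      simpa using hg.add (LipschitzWith.const z)
    obtain ⟨C, hC⟩ := hφ.lipschitzWith_of_hasCompactSupport hφc one_ne_zero
    have hL : LipschitzWith (C * (1 + K)) fun y => φ (graphPoint e (fun y => g y + z) y) :=
      hC.comp (lipschitzWith_graphPoint hgz)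
    have hS : HasCompactSupport fun y => φ (graphPoint e (fun y => g y + z) y) :=
      hφc.comp_isClosedEmbedding (isClosedEmbedding_graphPoint hgz.continuous)
    -- Integration by parts against the constant 1. The formula reverses the direction of
    -- differentiation, hence the minus sign.
    have hI := (LipschitzWith.const (1 : ℝ)).integral_lineDeriv_mul_eq (μ := volume)
      hL hS (-(e v).fst)
    have h0 : ∀ x w : E2, lineDeriv ℝ (fun _ : E2 => (1 : ℝ)) x w = 0 := fun x w => by
      simp [lineDeriv]
    simp only [neg_neg, mul_one, h0, zero_mul, integral_zero] at hI
    refine Eq.trans ?_ hI.symm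
    refine integral_congr_ae ?_
    filter_upwards [hg.ae_differentiableAt] with y hy
    have hyz : DifferentiableAt ℝ (fun y => g y + z) y := hy.add_const z
    have h1 := hasLineDerivAt_graphPoint (e := e) hyz (e v).fst
    have h2 : HasLineDerivAt ℝ (fun y => φ (graphPoint e (fun y => g y + z) y))
        (fderiv ℝ φ (graphPoint e (fun y => g y + z) y)
          (e.symm (WithLp.toLp 2 ((e v).fst, fderiv ℝ (fun y => g y + z) y (e v).fst))))
        y (e v).fst := by
      have hφd := (hφ.differentiable one_ne_zero) (graphPoint e (fun y => g y + z) y)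
      unfold HasLineDerivAt at h1 ⊢
      refine HasFDerivAt.comp_hasDerivAt (0 : ℝ) ?_ h1
      simpa using hφd.hasFDerivAt
    rw [h2.lineDeriv, fderiv_add_const, Pi.sub_apply, graphShear_eq_graphPoint, ← smul_eq_mul, ← map_smul,
      ← map_sub]
    congr 1
    apply e.injective
    rw [map_sub, map_smul, graphUp, LinearIsometryEquiv.apply_symm_apply,
      LinearIsometryEquiv.apply_symm_apply, graphConormal, ← WithLp.toLp_smul]
    apply (WithLp.equiv 2 (E2 × ℝ)).injective
    refine Prod.ext ?_ ?_ <;> simp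
  -- Only the vertical derivative remains. The conormal does not depend on z, so the fundamental
  -- theorem of calculus on (-∞, 0] evaluates φ on the graph.
  rw [integral_sub (hDi v) hCi, sub_eq_zero] at hzero
  rw [hzero, integral_prod _ hCi]
  refine integral_congr_ae (ae_of_all _ fun y => ?_)
  have hline : Topology.IsClosedEmbedding fun z : ℝ => graphShear e g (y, z) :=
    hce.comp (Function.LeftInverse.isClosedEmbedding (f := Prod.snd) (fun _ => rfl)
      continuous_snd (by fun_prop))
  simp only
  rw [integral_const_mul, ← graphShear_zero, ← integral_Iic_eq_integral_Iio]
  congr 1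
  have hder : ∀ z : ℝ, HasDerivAt (fun z => φ (graphShear e g (y, z)))
      (fderiv ℝ φ (graphShear e g (y, z)) (graphUp e)) z := fun z => by
    have h1 : HasDerivAt (fun z : ℝ => graphShear e g (y, z)) (graphUp e) z := by
      simp only [graphShear_eq_add]
      simpa using ((hasDerivAt_id z).smul_const (graphUp e)).const_add (graphPoint e g y)
    exact ((hφ.differentiable one_ne_zero) _).hasFDerivAt.comp_hasDerivAt z h1
  have hcd : ContDiff ℝ 1 fun z => φ (graphShear e g (y, z)) := by
    simp only [graphShear_eq_add]
    fun_prop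
  rw [← (hφc.comp_isClosedEmbedding hline).integral_Iic_deriv_eq hcd 0]
  exact integral_congr_ae (ae_of_all _ fun z => (hder z).deriv.symm)

end

section

open MeasureTheory Measure Set Filter Function
open scoped NNReal ENNReal

/-! ### The divergence theorem in a graph chart -/

/-- The divergence of a vector field given by its components. -/
def divergence (W : Fin 3 → E3 → ℝ) (x : E3) : ℝ :=
  ∑ η, fderiv ℝ (W η) x (EuclideanSpace.single η 1)

variable {e : E3 ≃ₗᵢ[ℝ] P3} {g : E2 → ℝ} {K : ℝ≥0} {A U C : Set E3} {W : Fin 3 → E3 → ℝ}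

theorem fderiv_eq_zero_of_notMem_isClosed {f : E3 → ℝ} (hC : IsClosed C)
    (hf : ∀ x, x ∉ C → f x = 0) {x : E3} (hx : x ∉ C) : fderiv ℝ f x = 0 := by
  have : f =ᶠ[𝓝 x] fun _ => 0 := by
    filter_upwards [hC.isOpen_compl.mem_nhds hx] with z hz using hf z hz
  rw [this.fderiv_eq]
  simp

theorem divergence_eq_zero (hC : IsClosed C) (hW : ∀ η x, x ∉ C → W η x = 0) {x : E3}
    (hx : x ∉ C) : divergence W x = 0 := by
  refine Finset.sum_eq_zero fun η _ => ?_
  rw [fderiv_eq_zero_of_notMem_isClosed hC (hW η) hx]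
  simp

/-- A `C¹` function on an open set, cut off smoothly, agrees with it on a compact subset. -/
theorem exists_contDiff_eq_on_compact {H D : Set E3} (hH : IsOpen H) (hD : IsCompact D)
    (hDH : D ⊆ H) : ∃ ψ : E3 → ℝ, (∀ x ∈ D, ψ x = 1) ∧ HasCompactSupport ψ ∧
      ∀ f : E3 → ℝ, ContDiffOn ℝ 1 f H → ContDiff ℝ 1 fun x => ψ x * f x := by
  obtain ⟨L, hL, hDL, hLH⟩ := exists_compact_between hD hH hDH
  obtain ⟨ψ, h0, h1, -⟩ := exists_contMDiffMap_zero_one_of_isClosed (modelWithCornersSelf ℝ E3)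
    (n := 1) (s := (interior L)ᶜ) (t := D) isOpen_interior.isClosed_compl hD.isClosed
    (disjoint_left.2 fun x hx hxD => hx (hDL hxD))
  have hsupp : tsupport ψ ⊆ L := closure_minimal
    (fun x hx => by
      by_contra hxL
      exact hx (h0 fun h => hxL (interior_subset h))) hL.isClosed
  refine ⟨ψ, fun x hx => h1 hx, hL.of_isClosed_subset (isClosed_tsupport _) hsupp,
    fun f hf => ?_⟩
  · rw [contDiff_iff_contDiffAt]
    intro x
    by_cases hx : x ∈ H
    · exact (ψ.contMDiff.contDiff.contDiffAt).mul (hf.contDiffAt (hH.mem_nhds hx))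
    · have hx' : x ∉ tsupport ψ := fun h => hx (hLH (hsupp h))
      have : (fun x => ψ x * f x) =ᶠ[𝓝 x] fun _ => 0 := by
        filter_upwards [notMem_tsupport_iff_eventuallyEq.1 hx'] with z hz
        rw [hz]
        simp
      exact contDiffAt_const.congr_of_eventuallyEq this

/-- W is C¹ only strictly below the graph. Lowering the graph by t makes the relevant part of C a
compact subset of that open region, where W agrees with a compactly supported C¹ field. -/
theorem integral_divergence_below_graph_sub (hg : LipschitzWith K g) (hC : IsCompact C)
    (hW0 : ∀ η x, x ∉ C → W η x = 0)
    (hW1 : ∀ η, ContDiffOn ℝ 1 (W η) {x | graphHeight e g x < 0}) {t : ℝ} (ht : 0 < t) :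
    ∫ x in {x | graphHeight e g x < -t}, divergence W x
      = ∫ y, ∑ η, graphConormal e g y (EuclideanSpace.single η 1)
          * W η (graphPoint e g y - t • graphUp e) := by
  have hhc := continuous_graphHeight (e := e) hg.continuous
  have hHo : IsOpen {x | graphHeight e g x < 0} := isOpen_lt hhc continuous_const
  have hD : IsCompact (C ∩ {x | graphHeight e g x ≤ -t}) :=
    hC.inter_right (isClosed_le hhc continuous_const)
  obtain ⟨ψ, hψ1, hψc, hψd⟩ := exists_contDiff_eq_on_compact hHo hD fun x hx => by
    have : graphHeight e g x ≤ -t := hx.2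
    simp only [mem_ofPred_eq]
    linarith
  have hgt : LipschitzWith K fun y => g y + -t := by simpa using hg.add (LipschitzWith.const (-t))
  have hheq : {x | graphHeight e g x < -t} = {x | graphHeight e (fun y => g y + -t) x < 0} := by
    ext x
    simp only [graphHeight, mem_ofPred_eq]
    constructor <;> intro h <;> linarith
  have hφ : ∀ η x, graphHeight e g x ≤ -t → ψ x * W η x = W η x := fun η x hx => by
    by_cases hxC : x ∈ C
    · rw [hψ1 x ⟨hxC, hx⟩, one_mul]
    · rw [hW0 η x hxC, mul_zero]
  have hcs : ∀ η, HasCompactSupport fun x => ψ x * W η x := fun η => hψc.mul_right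
  have hcd := fun η => hψd (W η) (hW1 η)
  have hpt : ∀ y, graphPoint e (fun y => g y + -t) y = graphPoint e g y - t • graphUp e := fun y => by
    rw [← graphShear_eq_graphPoint, graphShear_eq_add, neg_smul, sub_eq_add_neg]
  have hopen : IsOpen {x | graphHeight e g x < -t} := isOpen_lt hhc continuous_const
  calc ∫ x in {x | graphHeight e g x < -t}, divergence W x
      = ∫ x in {x | graphHeight e g x < -t},
          ∑ η, fderiv ℝ (fun x => ψ x * W η x) x (EuclideanSpace.single η 1) := by
        refine setIntegral_congr_fun hopen.measurableSet fun x hx => ?_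
        refine Finset.sum_congr rfl fun η _ => ?_
        congr 1
        refine Filter.EventuallyEq.fderiv_eq ?_
        filter_upwards [hopen.mem_nhds hx] with z hz
        exact (hφ η z (le_of_lt hz)).symm
    _ = ∑ η, ∫ x in {x | graphHeight e (fun y => g y + -t) x < 0},
          fderiv ℝ (fun x => ψ x * W η x) x (EuclideanSpace.single η 1) := by
        rw [← hheq]
        refine integral_finsetSum _ fun η _ => Integrable.integrableOn ?_
        exact (((hcd η).continuous_fderiv one_ne_zero).clm_apply
          continuous_const).integrable_of_hasCompactSupport ((hcs η).fderiv_apply (𝕜 := ℝ) _)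
    _ = ∑ η, ∫ y, graphConormal e g y (EuclideanSpace.single η 1)
          * W η (graphPoint e g y - t • graphUp e) := by
        refine Finset.sum_congr rfl fun η _ => ?_
        rw [integral_fderiv_below_graph hgt (hcd η) (hcs η)]
        refine integral_congr_ae (ae_of_all _ fun y => ?_)
        simp only [graphConormal, fderiv_add_const]
        rw [hφ, hpt]
        rw [hpt, sub_eq_add_neg, ← neg_smul, graphHeight_add_up,
          ← graphShear_zero, graphHeight_graphShear]
        simp
    _ = _ := by
        refine (integral_finsetSum _ fun η _ => ?_).symm
        have hcont : Continuous fun y => W η (graphPoint e g y - t • graphUp e) := by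
          have : (fun y => W η (graphPoint e g y - t • graphUp e))
              = fun y => (fun x => ψ x * W η x) (graphPoint e (fun y => g y + -t) y) := by
            funext y
            simp only
            rw [hφ, hpt]
            rw [hpt, sub_eq_add_neg, ← neg_smul, graphHeight_add_up,
              ← graphShear_zero, graphHeight_graphShear]
            simp
          rw [this]
          exact (hcd η).continuous.comp (continuous_graphPoint hgt.continuous)
        have hsup : HasCompactSupport fun y => W η (graphPoint e g y - t • graphUp e) := by
          simp only [← hpt]
          exact (HasCompactSupport.intro hC (hW0 η)).comp_isClosedEmbedding
            (isClosedEmbedding_graphPoint hgt.continuous)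
        exact (hcont.integrable_of_hasCompactSupport hsup).bdd_mul (c := (1 + K) * ‖_‖)
          (measurable_graphConormal _).aestronglyMeasurable
          (ae_of_all _ fun y => abs_graphConormal_le hg y _)

/-- Let t → 0. The volume integrals converge by monotone exhaustion and integrability of the
divergence, the surface integrals by dominated convergence. -/
theorem integral_divergence_below_graph (hg : LipschitzWith K g) (hC : IsCompact C)
    (hW0 : ∀ η x, x ∉ C → W η x = 0)
    (hW1 : ∀ η, ContDiffOn ℝ 1 (W η) {x | graphHeight e g x < 0})
    (hWc : ∀ η, ContinuousOn (W η) {x | graphHeight e g x ≤ 0})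
    (hint : IntegrableOn (divergence W) {x | graphHeight e g x < 0}) :
    ∫ x in {x | graphHeight e g x < 0}, divergence W x
      = ∫ y, ∑ η, graphConormal e g y (EuclideanSpace.single η 1) * W η (graphPoint e g y) := by
  have hhc := continuous_graphHeight (e := e) hg.continuous
  set τ : ℕ → ℝ := fun n => 1 / ((n : ℝ) + 1) with hτ
  have hτ0 : ∀ n, 0 < τ n := fun n => by positivity
  have hτt : Tendsto τ atTop (𝓝 0) := tendsto_one_div_add_atTop_nhds_zero_nat
  have hτm : Antitone τ := fun m n h => one_div_le_one_div_of_le (by positivity) (by simpa using h)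
  have hU : {x | graphHeight e g x < 0} = ⋃ n, {x | graphHeight e g x < -τ n} := by
    ext x
    simp only [mem_ofPred_eq, mem_iUnion]
    constructor
    · intro hx
      obtain ⟨n, hn⟩ := (hτt.eventually (gt_mem_nhds (neg_pos.2 hx))).exists
      exact ⟨n, by linarith⟩
    · rintro ⟨n, hn⟩
      linarith [hτ0 n]
  have hL : Tendsto (fun n => ∫ x in {x | graphHeight e g x < -τ n}, divergence W x) atTop
      (𝓝 (∫ x in {x | graphHeight e g x < 0}, divergence W x)) := by
    rw [hU]
    refine tendsto_setIntegral_of_monotone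
      (fun n => (isOpen_lt hhc continuous_const).measurableSet) (fun m n h x hx => ?_) (hU ▸ hint)
    have := hτm h
    simp only [mem_ofPred_eq] at hx ⊢
    linarith
  have hht : ∀ y t, graphHeight e g (graphPoint e g y - t • graphUp e) = -t := fun y t => by
    rw [sub_eq_add_neg, ← neg_smul, graphHeight_add_up, ← graphShear_zero, graphHeight_graphShear]
    simp
  have hbd : ∃ M, ∀ η x, graphHeight e g x ≤ 0 → |W η x| ≤ M := by
    have hD : IsCompact (C ∩ {x | graphHeight e g x ≤ 0}) :=
      hC.inter_right (isClosed_le hhc continuous_const)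
    choose M hM using fun η => hD.exists_bound_of_continuousOn ((hWc η).mono inter_subset_right)
    refine ⟨∑ η, |M η|, fun η x hx => ?_⟩
    have h1 : |M η| ≤ ∑ η, |M η| := Finset.single_le_sum (f := fun η => |M η|)
      (fun _ _ => abs_nonneg _) (Finset.mem_univ η)
    refine le_trans ?_ h1
    by_cases hxC : x ∈ C
    · exact (hM η x ⟨hxC, hx⟩).trans (le_abs_self _)
    · rw [hW0 η x hxC]
      simp
  obtain ⟨M, hM⟩ := hbd
  have hM0 : 0 ≤ M := (abs_nonneg _).trans
    (hM 0 (graphPoint e g 0 - (1 : ℝ) • graphUp e) (by rw [hht]; norm_num))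
  have hB : IsCompact ((fun x : E3 => (e x).fst) '' C) := hC.image (by fun_prop)
  have hR : Tendsto (fun n => ∫ y, ∑ η, graphConormal e g y (EuclideanSpace.single η 1)
          * W η (graphPoint e g y - τ n • graphUp e)) atTop
      (𝓝 (∫ y, ∑ η, graphConormal e g y (EuclideanSpace.single η 1)
          * W η (graphPoint e g y))) := by
    -- Three components, each with conormal at most 1 + K and field at most M, supported over the
    -- shadow of C.
    refine tendsto_integral_of_dominated_convergence
      (((fun x : E3 => (e x).fst) '' C).indicator fun _ => 3 * ((1 + K) * M)) (fun n => ?_) ?_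
      (fun n => ae_of_all _ fun y => ?_) (ae_of_all _ fun y => ?_)
    · refine Finset.aestronglyMeasurable_fun_sum _ fun η _ =>
        (measurable_graphConormal _).aestronglyMeasurable.mul ?_
      refine Continuous.aestronglyMeasurable ((hWc η).comp_continuous ?_ fun y => ?_)
      · exact (continuous_graphPoint hg.continuous).sub continuous_const
      · simp only [mem_ofPred_eq]
        rw [hht]
        linarith [hτ0 n]
    · exact (integrable_indicator_iff hB.measurableSet).2
        (integrableOn_const hB.measure_lt_top.ne)
    · by_cases hy : y ∈ (fun x : E3 => (e x).fst) '' C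
      · rw [indicator_of_mem hy]
        refine (norm_sum_le _ _).trans ?_
        have : ∀ η ∈ (Finset.univ : Finset (Fin 3)),
            ‖graphConormal e g y (EuclideanSpace.single η 1)
              * W η (graphPoint e g y - τ n • graphUp e)‖ ≤ (1 + K) * M := fun η _ => by
          rw [norm_mul]
          have h1 := abs_graphConormal_le (e := e) hg y (EuclideanSpace.single η 1)
          rw [PiLp.norm_single, norm_one, mul_one] at h1
          have h2 := hM η (graphPoint e g y - τ n • graphUp e) (by rw [hht]; linarith [hτ0 n])
          exact mul_le_mul h1 h2 (abs_nonneg _) (by positivity)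
        simpa using Finset.sum_le_card_nsmul _ _ _ this
      · rw [indicator_of_notMem hy, Finset.sum_eq_zero, norm_zero]
        intro η _
        rw [hW0, mul_zero]
        intro hmem
        refine hy ⟨_, hmem, ?_⟩
        simp [apply_graphPoint, graphMap, graphUp]
    · refine tendsto_finsetSum _ fun η _ => Tendsto.const_mul _ ?_
      have h0 : graphPoint e g y ∈ {x | graphHeight e g x ≤ 0} := by
        have := hht y 0
        rw [zero_smul, sub_zero] at this
        simp [this]
      refine (hWc η _ h0).tendsto.comp (tendsto_nhdsWithin_iff.2 ⟨?_, Eventually.of_forall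
        fun n => ?_⟩)
      · have : Continuous fun t : ℝ => graphPoint e g y - t • graphUp e := by fun_prop
        simpa [Function.comp_def] using (this.tendsto 0).comp hτt
      · simp only [mem_ofPred_eq]
        rw [hht]
        linarith [hτ0 n]
  refine tendsto_nhds_unique hL (hR.congr fun n => ?_)
  exact (integral_divergence_below_graph_sub hg hC hW0 hW1 (hτ0 n)).symm

/-- The divergence theorem for a field supported in a graph chart. -/
theorem IsGraphChart.integral_divergence (h : IsGraphChart A U e g K) (hA : IsOpen A)
    (hC : IsCompact C) (hCU : C ⊆ U) (hW0 : ∀ η x, x ∉ C → W η x = 0)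
    (hW1 : ∀ η, ContDiffOn ℝ 1 (W η) A) (hWc : ∀ η, ContinuousOn (W η) (closure A))
    (hint : IntegrableOn (divergence W) A) :
    ∫ x in A, divergence W x
      = ∫ x in frontier A, ∑ η, W η x * outwardNormal A x η ∂μHE[2] := by
  have hhc := continuous_graphHeight (e := e) h.lipschitz.continuous
  have hHo : IsOpen {x | graphHeight e g x < 0} := isOpen_lt hhc continuous_const
  have hz : ∀ x, x ∉ C → divergence W x = 0 := fun x hx => divergence_eq_zero hC.isClosed hW0 hx
  -- The set A and the full subgraph agree only within the chart. That is enough, since the field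
  -- vanishes off C.
  have hAC : A ∩ C = {x | graphHeight e g x < 0} ∩ C := by
    ext x
    constructor
    · rintro ⟨h1, h2⟩; exact ⟨(h.mem_iff' (hCU h2)).1 h1, h2⟩
    · rintro ⟨h1, h2⟩; exact ⟨(h.mem_iff' (hCU h2)).2 h1, h2⟩
  have hW1' : ∀ η, ContDiffOn ℝ 1 (W η) {x | graphHeight e g x < 0} := fun η x hx => by
    by_cases hxC : x ∈ C
    · exact ((hW1 η).contDiffAt (hA.mem_nhds ((h.mem_iff' (hCU hxC)).2 hx))).contDiffWithinAt
    · refine ContDiffAt.contDiffWithinAt (contDiffAt_const (c := (0 : ℝ)) |>.congr_of_eventuallyEq ?_)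
      filter_upwards [hC.isClosed.isOpen_compl.mem_nhds hxC] with z hz using hW0 η z hz
  have hWc' : ∀ η, ContinuousOn (W η) {x | graphHeight e g x ≤ 0} := fun η x hx => by
    by_cases hxC : x ∈ C
    · have h1 := hWc η x ((h.mem_closure_iff (hCU hxC)).2 hx)
      refine h1.mono_of_mem_nhdsWithin ?_
      filter_upwards [mem_nhdsWithin_of_mem_nhds (h.isOpen.mem_nhds (hCU hxC)),
        self_mem_nhdsWithin] with z hz1 hz2 using (h.mem_closure_iff hz1).2 hz2
    · refine ContinuousAt.continuousWithinAt (continuousAt_const (y := (0 : ℝ)) |>.congr ?_)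
      filter_upwards [hC.isClosed.isOpen_compl.mem_nhds hxC] with z hz using (hW0 η z hz).symm
  have hint' : IntegrableOn (divergence W) {x | graphHeight e g x < 0} := by
    have h1 : IntegrableOn (divergence W) ({x | graphHeight e g x < 0} ∩ C) :=
      hAC ▸ hint.mono_set inter_subset_left
    exact h1.of_forall_sdiff_eq_zero hHo.measurableSet fun x hx =>
      hz x fun hxC => hx.2 ⟨hx.1, hxC⟩
  have e1 : ∫ x in A, divergence W x = ∫ x in {x | graphHeight e g x < 0}, divergence W x := by
    rw [setIntegral_eq_of_subset_of_forall_sdiff_eq_zero hA.measurableSet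
        (inter_subset_left (t := C)) fun x hx => hz x fun hxC => hx.2 ⟨hx.1, hxC⟩, hAC,
      ← setIntegral_eq_of_subset_of_forall_sdiff_eq_zero hHo.measurableSet
        inter_subset_left fun x hx => hz x fun hxC => hx.2 ⟨hx.1, hxC⟩]
  have hFz : ∀ x, x ∉ C → ∑ η, W η x * outwardNormal A x η = 0 := fun x hx =>
    Finset.sum_eq_zero fun η _ => by rw [hW0 η x hx, zero_mul]
  have hfr : frontier A ∩ C = range (graphPoint e g) ∩ C := by
    ext x
    constructor
    · rintro ⟨h1, h2⟩; exact ⟨(h.mem_frontier_iff hA (hCU h2)).1 h1, h2⟩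
    · rintro ⟨h1, h2⟩; exact ⟨(h.mem_frontier_iff hA (hCU h2)).2 h1, h2⟩
  have e2 : ∫ x in frontier A, ∑ η, W η x * outwardNormal A x η ∂μHE[2]
      = ∫ x in range (graphPoint e g), ∑ η, W η x * outwardNormal A x η ∂μHE[2] := by
    rw [setIntegral_eq_of_subset_of_forall_sdiff_eq_zero isClosed_frontier.measurableSet
        (inter_subset_left (t := C)) fun x hx => hFz x fun hxC => hx.2 ⟨hx.1, hxC⟩, hfr,
      ← setIntegral_eq_of_subset_of_forall_sdiff_eq_zero
        (isClosedEmbedding_graphPoint h.lipschitz.continuous).isClosed_range.measurableSet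
        inter_subset_left fun x hx => hFz x fun hxC => hx.2 ⟨hx.1, hxC⟩]
  rw [e1, e2, integral_range_graphPoint h.lipschitz,
    integral_divergence_below_graph h.lipschitz hC hW0 hW1' hWc' hint']
  refine integral_congr_ae ?_
  filter_upwards [h.jac_mul_outwardNormal hA] with y hy
  rw [Finset.mul_sum]
  refine Finset.sum_congr rfl fun η _ => ?_
  by_cases hyC : graphPoint e g y ∈ C
  · rw [← hy (hCU hyC) η]
    ring
  · rw [hW0 η _ hyC]
    ring

end

section

open MeasureTheory Measure Set Filter Function
open scoped NNReal ENNReal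

/-! ### The divergence theorem on bounded Lipschitz domains -/

variable {A : Set E3} {W : Fin 3 → E3 → ℝ}

theorem IsLipschitzDomain.isCompact_closure (hA : IsLipschitzDomain A) : IsCompact (closure A) :=
  hA.isBounded.isCompact_closure

theorem IsLipschitzDomain.isCompact_frontier (hA : IsLipschitzDomain A) : IsCompact (frontier A) :=
  hA.isCompact_closure.of_isClosed_subset isClosed_frontier frontier_subset_closure

theorem IsLipschitzDomain.exists_charts (hA : IsLipschitzDomain A) :
    ∃ (U : frontier A → Set E3) (e : frontier A → E3 ≃ₗᵢ[ℝ] P3) (g : frontier A → E2 → ℝ)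
      (K : frontier A → ℝ≥0) (t : Finset (frontier A)),
      (∀ i, IsGraphChart A (U i) (e i) (g i) (K i)) ∧ frontier A ⊆ ⋃ i : t, U i := by
  choose! U e g K h1 h2 h3 h4 using fun x : frontier A => hA.local_graph x x.2
  obtain ⟨t, ht⟩ := hA.isCompact_frontier.elim_finite_subcover U h1 fun x hx =>
    mem_iUnion.2 ⟨⟨x, hx⟩, h2 ⟨x, hx⟩⟩
  refine ⟨U, e, g, K, t, fun i => ⟨h1 i, h3 i, h4 i⟩, ht.trans fun x hx => ?_⟩
  simp only [mem_iUnion] at hx ⊢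
  obtain ⟨i, hi, hxi⟩ := hx
  exact ⟨⟨i, hi⟩, hxi⟩

theorem IsLipschitzDomain.measure_frontier_lt_top (hA : IsLipschitzDomain A) :
    μHE[2] (frontier A) < ∞ := by
  obtain ⟨U, e, g, K, t, hch, hcov⟩ := hA.exists_charts
  have hsub : frontier A ⊆ ⋃ i : t, range (graphPoint (e i) (g i)) ∩ frontier A := fun x hx => by
    obtain ⟨i, hi⟩ := mem_iUnion.1 (hcov hx)
    exact mem_iUnion.2 ⟨i, ((hch i).mem_frontier_iff hA.isOpen hi).1 hx, hx⟩
  refine (measure_mono hsub).trans_lt ((measure_iUnion_fintype_le _ _).trans_lt ?_)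
  exact ENNReal.sum_lt_top.2 fun i _ => measure_range_graphPoint_inter_lt_top (hch i).lipschitz
    hA.isCompact_frontier.isBounded

theorem IsLipschitzDomain.ae_exists_normal (hA : IsLipschitzDomain A) :
    ∀ᵐ x ∂(μHE[2].restrict (frontier A)), ∃ n, IsOutwardNormal A x n := by
  obtain ⟨U, e, g, K, t, hch, hcov⟩ := hA.exists_charts
  have hsub : frontier A ⊆ ⋃ i : t, range (graphPoint (e i) (g i)) ∩ U i := fun x hx => by
    obtain ⟨i, hi⟩ := mem_iUnion.1 (hcov hx)
    exact mem_iUnion.2 ⟨i, ((hch i).mem_frontier_iff hA.isOpen hi).1 hx, hi⟩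
  refine ae_restrict_of_ae_restrict_of_subset hsub ?_
  rw [ae_restrict_iUnion_iff]
  intro i
  have hr : MeasurableSet (range (graphPoint (e i) (g i))) :=
    (isClosedEmbedding_graphPoint (hch i).lipschitz.continuous).isClosed_range.measurableSet
  rw [ae_restrict_iff' (hr.inter (hch i).isOpen.measurableSet)]
  have h1 := ae_restrict_range_graphPoint (e := e i) (hch i).lipschitz
    (p := fun x => x ∈ U i → ∃ n, IsOutwardNormal A x n) (by
      filter_upwards [(hch i).lipschitz.ae_differentiableAt] with y hy hyU
      exact ⟨_, (hch i).isOutwardNormal hA.isOpen hyU hy⟩)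
  rw [ae_restrict_iff' hr] at h1
  filter_upwards [h1] with x hx hxU using hx hxU.1 hxU.2

/-- The normal field is defined by choice. In a chart it is almost everywhere the conormal divided
by the Jacobian, which is measurable because `fderiv` is. -/
theorem IsLipschitzDomain.aestronglyMeasurable_outwardNormal (hA : IsLipschitzDomain A)
    (η : Fin 3) :
    AEStronglyMeasurable (fun x => outwardNormal A x η) (μHE[2].restrict (frontier A)) := by
  obtain ⟨U, e, g, K, t, hch, hcov⟩ := hA.exists_charts
  have hsub : frontier A ⊆ ⋃ i : t, range (graphPoint (e i) (g i)) ∩ U i := fun x hx => by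
    obtain ⟨i, hi⟩ := mem_iUnion.1 (hcov hx)
    exact mem_iUnion.2 ⟨i, ((hch i).mem_frontier_iff hA.isOpen hi).1 hx, hi⟩
  suffices h : AEStronglyMeasurable (fun x => outwardNormal A x η)
      (μHE[2].restrict (⋃ i : t, range (graphPoint (e i) (g i)) ∩ U i)) from
    h.mono_measure (Measure.restrict_mono hsub le_rfl)
  rw [aestronglyMeasurable_iUnion_iff]
  intro i
  have hUm := (hch i).isOpen.measurableSet
  have hgc := (hch i).lipschitz.continuous
  rw [inter_comm, ← Measure.restrict_restrict hUm, ← aestronglyMeasurable_indicator_iff hUm]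
  refine aestronglyMeasurable_range_graphPoint (hch i).lipschitz ?_
  have hm : Measurable ((graphPoint (e i) (g i) ⁻¹' U i).indicator fun y =>
      (graphJac (fderiv ℝ (g i) y))⁻¹
        * graphConormal (e i) (g i) y (EuclideanSpace.single η 1)) :=
    (measurable_fderiv_jac.inv.mul (measurable_graphConormal _)).indicator
      ((continuous_graphPoint hgc).measurable hUm)
  refine hm.aestronglyMeasurable.congr ?_
  filter_upwards [(hch i).jac_mul_outwardNormal hA.isOpen] with y hy
  by_cases hyU : graphPoint (e i) (g i) y ∈ U i
  · rw [indicator_of_mem hyU, indicator_of_mem (by exact hyU), ← hy hyU η, inv_mul_cancel_left₀]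
    linarith [one_le_graphJac (fderiv ℝ (g i) y)]
  · rw [indicator_of_notMem hyU, indicator_of_notMem (by exact hyU)]

theorem integral_fderiv_eq_zero {φ : E3 → ℝ} (hφ : ContDiff ℝ 1 φ) (hφc : HasCompactSupport φ)
    (v : E3) : ∫ x, fderiv ℝ φ x v = 0 := by
  obtain ⟨C, hC⟩ := hφ.lipschitzWith_of_hasCompactSupport hφc one_ne_zero
  have hI := (LipschitzWith.const (α := E3) (1 : ℝ)).integral_lineDeriv_mul_eq (μ := volume)
    hC hφc (-v)
  have h0 : ∀ x w : E3, lineDeriv ℝ (fun _ : E3 => (1 : ℝ)) x w = 0 := fun x w => by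
    simp [lineDeriv]
  simp only [neg_neg, mul_one, h0, zero_mul, integral_zero] at hI
  rw [hI]
  exact integral_congr_ae (ae_of_all _ fun x =>
    ((hφ.differentiable one_ne_zero x).lineDeriv_eq_fderiv (v := v)).symm)

/-- The divergence theorem for a field with compact support inside the domain. -/
theorem integral_divergence_of_compact_subset (hA : IsOpen A) {C : Set E3} (hC : IsCompact C)
    (hCA : C ⊆ A) (hW0 : ∀ η x, x ∉ C → W η x = 0) (hW1 : ∀ η, ContDiffOn ℝ 1 (W η) A) :
    ∫ x in A, divergence W x
      = ∫ x in frontier A, ∑ η, W η x * outwardNormal A x η ∂μHE[2] := by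
  have hcd : ∀ η, ContDiff ℝ 1 (W η) := fun η => contDiff_iff_contDiffAt.2 fun x => by
    by_cases hx : x ∈ C
    · exact (hW1 η).contDiffAt (hA.mem_nhds (hCA hx))
    · refine contDiffAt_const (c := (0 : ℝ)) |>.congr_of_eventuallyEq ?_
      filter_upwards [hC.isClosed.isOpen_compl.mem_nhds hx] with z hz using hW0 η z hz
  have hcs : ∀ η, HasCompactSupport (W η) := fun η => HasCompactSupport.intro hC (hW0 η)
  have e1 : ∫ x in A, divergence W x = 0 := by
    rw [setIntegral_eq_integral_of_forall_compl_eq_zero fun x hx =>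
      divergence_eq_zero hC.isClosed hW0 fun h => hx (hCA h)]
    unfold divergence
    rw [integral_finsetSum _ fun η _ => (((hcd η).continuous_fderiv one_ne_zero).clm_apply
      continuous_const).integrable_of_hasCompactSupport ((hcs η).fderiv_apply (𝕜 := ℝ) _)]
    exact Finset.sum_eq_zero fun η _ => integral_fderiv_eq_zero (hcd η) (hcs η) _
  rw [e1]
  refine (setIntegral_eq_zero_of_forall_eq_zero fun x hx => ?_).symm
  refine Finset.sum_eq_zero fun η _ => ?_
  rw [hW0 η x fun h => ?_, zero_mul]
  rw [hA.frontier_eq] at hx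
  exact hx.2 (hCA h)

/-- A smooth partition of unity on the closure of a Lipschitz domain, subordinate to the domain
itself and finitely many graph charts. -/
theorem IsLipschitzDomain.exists_partition (hA : IsLipschitzDomain A) :
    ∃ (κ : Type) (_ : Fintype κ) (χ : κ → E3 → ℝ), (∀ k, ContDiff ℝ 1 (χ k)) ∧
      (∀ x ∈ closure A, ∑ k, χ k x = 1) ∧ (∀ k, HasCompactSupport (χ k)) ∧
      ∀ k, tsupport (χ k) ⊆ A ∨ ∃ U e g K, IsGraphChart A U e g K ∧ tsupport (χ k) ⊆ U := by
  obtain ⟨U, e, g, K, t, hch, hcov⟩ := hA.exists_charts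
  -- Charts may be unbounded. Cutting them with a ball makes the supports compact.
  obtain ⟨R, hR⟩ := hA.isBounded.closure.subset_ball 0
  let V : Option t → Set E3 := fun k => k.elim A fun i => U i ∩ Metric.ball 0 R
  have hVo : ∀ k, IsOpen (V k) := by
    rintro (_ | i)
    · exact hA.isOpen
    · exact (hch i).isOpen.inter Metric.isOpen_ball
  have hVc : closure A ⊆ ⋃ k, V k := fun x hx => by
    by_cases hxA : x ∈ A
    · exact mem_iUnion.2 ⟨none, hxA⟩
    · have hxf : x ∈ frontier A := by rw [hA.isOpen.frontier_eq]; exact ⟨hx, hxA⟩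
      obtain ⟨i, hi⟩ := mem_iUnion.1 (hcov hxf)
      exact mem_iUnion.2 ⟨some i, hi, hR hx⟩
  obtain ⟨f, hf⟩ := SmoothPartitionOfUnity.exists_isSubordinate (modelWithCornersSelf ℝ E3)
    isClosed_closure V hVo hVc
  refine ⟨Option t, inferInstance, fun k => f k, fun k => ?_, fun x hx => ?_, fun k => ?_,
    fun k => ?_⟩
  · exact ((f k).contMDiff.contDiff).of_le (by exact_mod_cast le_top)
  · rw [← finsum_eq_sum_of_fintype]
    exact f.sum_eq_one hx
  · have hb : Bornology.IsBounded (V k) := by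
      cases k with
      | none => exact hA.isBounded
      | some i => exact Metric.isBounded_ball.subset inter_subset_right
    exact Metric.isCompact_of_isClosed_isBounded (isClosed_tsupport _) (hb.subset (hf k))
  · cases k with
    | none => exact Or.inl (hf none)
    | some i => exact Or.inr ⟨_, _, _, _, hch i, (hf (some i)).trans inter_subset_left⟩

theorem IsLipschitzDomain.integrableOn_frontier (hA : IsLipschitzDomain A) {w : E3 → ℝ}
    (hw : ContinuousOn w (closure A)) (η : Fin 3) :
    IntegrableOn (fun x => w x * outwardNormal A x η) (frontier A) μHE[2] := by
  have hw' := hw.mono frontier_subset_closure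
  obtain ⟨M, hM⟩ := hA.isCompact_frontier.exists_bound_of_continuousOn hw'
  have : IsFiniteMeasure ((μHE[2] : Measure E3).restrict (frontier A)) :=
    ⟨by rw [Measure.restrict_apply_univ]; exact hA.measure_frontier_lt_top⟩
  refine Integrable.of_bound ((hw'.aestronglyMeasurable isClosed_frontier.measurableSet).mul
    (hA.aestronglyMeasurable_outwardNormal η)) M ?_
  filter_upwards [ae_restrict_mem isClosed_frontier.measurableSet] with x hx
  have h1 : ‖outwardNormal A x η‖ ≤ 1 :=
    (PiLp.norm_apply_le _ _).trans (norm_outwardNormal_le A x)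
  rw [norm_mul]
  calc ‖w x‖ * ‖outwardNormal A x η‖ ≤ ‖w x‖ * 1 := by gcongr
    _ ≤ M := by rw [mul_one]; exact hM x hx

/-- **The divergence theorem** on a bounded Lipschitz domain, for a vector field that is continuous
up to the boundary and continuously differentiable inside with integrable divergence. -/
theorem IsLipschitzDomain.integral_divergence (hA : IsLipschitzDomain A)
    (hW1 : ∀ η, ContDiffOn ℝ 1 (W η) A) (hWc : ∀ η, ContinuousOn (W η) (closure A))
    (hint : IntegrableOn (divergence W) A) :
    ∫ x in A, divergence W x
      = ∫ x in frontier A, ∑ η, W η x * outwardNormal A x η ∂μHE[2] := by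
  obtain ⟨κ, _, χ, hχ, hsum, hsupp, hsub⟩ := hA.exists_partition
  have hd : ∀ k, ∀ x ∈ A, divergence (fun η x => χ k x * W η x) x
      = χ k x * divergence W x
        + ∑ η, fderiv ℝ (χ k) x (EuclideanSpace.single η 1) * W η x := fun k x hx => by
    unfold divergence
    rw [Finset.mul_sum, ← Finset.sum_add_distrib]
    refine Finset.sum_congr rfl fun η _ => ?_
    have h1 := (hχ k).differentiable one_ne_zero x
    have h2 := ((hW1 η).contDiffAt (hA.isOpen.mem_nhds hx)).differentiableAt one_ne_zero
    rw [fderiv_fun_mul h1 h2]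
    simp
    ring
  have hWi : ∀ k η, IntegrableOn
      (fun x => fderiv ℝ (χ k) x (EuclideanSpace.single η 1) * W η x) A := fun k η => by
    have hc : ContinuousOn (fun x => fderiv ℝ (χ k) x (EuclideanSpace.single η 1) * W η x)
        (closure A) :=
      (((hχ k).continuous_fderiv one_ne_zero).clm_apply continuous_const).continuousOn.mul (hWc η)
    exact (hc.integrableOn_compact hA.isCompact_closure).mono_set subset_closure
  have hχi : ∀ k, IntegrableOn (fun x => χ k x * divergence W x) A := fun k => by
    obtain ⟨M, hM⟩ := (hsupp k).exists_bound_of_continuous (hχ k).continuous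
    exact hint.bdd_mul (c := M) (hχ k).continuous.aestronglyMeasurable (ae_of_all _ hM)
  have hdi : ∀ k, IntegrableOn (divergence fun η x => χ k x * W η x) A := fun k => by
    refine ((hχi k).add (integrable_finsetSum Finset.univ fun η _ => hWi k η)).congr ?_
    filter_upwards [ae_restrict_mem hA.isOpen.measurableSet] with x hx
    simp [hd k x hx]
  have hloc : ∀ k, ∫ x in A, divergence (fun η x => χ k x * W η x) x
      = ∫ x in frontier A, ∑ η, χ k x * W η x * outwardNormal A x η ∂μHE[2] := fun k => by
    have h0 : ∀ η x, x ∉ tsupport (χ k) → χ k x * W η x = 0 := fun η x hx => by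
      rw [image_eq_zero_of_notMem_tsupport hx, zero_mul]
    have h1 : ∀ η, ContDiffOn ℝ 1 (fun x => χ k x * W η x) A := fun η =>
      (hχ k).contDiffOn.mul (hW1 η)
    have h2 : ∀ η, ContinuousOn (fun x => χ k x * W η x) (closure A) := fun η =>
      (hχ k).continuous.continuousOn.mul (hWc η)
    rcases hsub k with hk | ⟨U, e, g, K, hch, hk⟩
    · exact integral_divergence_of_compact_subset hA.isOpen (hsupp k) hk h0 h1
    · exact hch.integral_divergence hA.isOpen (hsupp k) hk h0 h1 h2 (hdi k)
  -- The partition sums to 1 near points of A, so the terms with derivatives of the cut-offs cancel.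
  have hsumA : ∀ x ∈ A, ∀ v, ∑ k, fderiv ℝ (χ k) x v = 0 := fun x hx v => by
    have h1 : (fun x => ∑ k, χ k x) =ᶠ[𝓝 x] fun _ => 1 := by
      filter_upwards [hA.isOpen.mem_nhds hx] with z hz using hsum z (subset_closure hz)
    have h2 : fderiv ℝ (fun x => ∑ k, χ k x) x = fderiv ℝ (fun _ => (1 : ℝ)) x := h1.fderiv_eq
    rw [fderiv_fun_sum fun k _ => (hχ k).differentiable one_ne_zero x] at h2
    simpa using congrArg (fun L => L v) h2
  calc ∫ x in A, divergence W x
      = ∫ x in A, ∑ k, divergence (fun η x => χ k x * W η x) x := by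
        refine setIntegral_congr_fun hA.isOpen.measurableSet fun x hx => ?_
        rw [Finset.sum_congr rfl fun k _ => hd k x hx, Finset.sum_add_distrib, ← Finset.sum_mul,
          hsum x (subset_closure hx), one_mul, Finset.sum_comm, left_eq_add]
        exact Finset.sum_eq_zero fun η _ => by rw [← Finset.sum_mul, hsumA x hx, zero_mul]
    _ = ∑ k, ∫ x in frontier A, ∑ η, χ k x * W η x * outwardNormal A x η ∂μHE[2] := by
        rw [integral_finsetSum _ fun k _ => hdi k]
        exact Finset.sum_congr rfl fun k _ => hloc k
    _ = ∫ x in frontier A, ∑ k, ∑ η, χ k x * W η x * outwardNormal A x η ∂μHE[2] := by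
        refine (integral_finsetSum _ fun k _ => integrable_finsetSum _ fun η _ => ?_).symm
        exact hA.integrableOn_frontier ((hχ k).continuous.continuousOn.mul (hWc η)) η
    _ = _ := by
        refine setIntegral_congr_fun isClosed_frontier.measurableSet fun x hx => ?_
        simp only
        rw [Finset.sum_comm]
        refine Finset.sum_congr rfl fun η _ => ?_
        rw [← Finset.sum_mul, ← Finset.sum_mul, hsum x (frontier_subset_closure hx), one_mul]

/-- The closure of a Lipschitz domain has unique derivatives. -/
theorem IsLipschitzDomain.uniqueDiffOn_closure (hA : IsLipschitzDomain A) :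
    UniqueDiffOn ℝ (closure A) := by
  intro x hx
  by_cases hxA : x ∈ A
  · exact (hA.isOpen.uniqueDiffWithinAt hxA).mono subset_closure
  have hxf : x ∈ frontier A := by rw [hA.isOpen.frontier_eq]; exact ⟨hx, hxA⟩
  obtain ⟨U, e, g, K, hU, hxU, hg, hAU⟩ := hA.local_graph x hxf
  have hch : IsGraphChart A U e g K := ⟨hU, hg, hAU⟩
  have hh : graphHeight e g x = 0 := by
    have := mem_range_graphPoint.1 ((hch.mem_frontier_iff hA.isOpen hxU).1 hxf)
    rw [graphHeight, this, sub_self]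
  -- The open convex cone of slope K hanging from the boundary point x lies below the graph, hence
  -- in A near x. Convexity with nonempty interior gives unique differentials at its apex.
  set S : Set E3 := {y | K * ‖(e (y - x)).fst‖ + (e (y - x)).snd < 0} with hS
  have hSo : IsOpen S := isOpen_lt (by fun_prop) continuous_const
  have hSc : Convex ℝ S := by
    have h1 : ConvexOn ℝ univ fun y : E3 => (K : ℝ) * ‖(e (y - x)).fst‖ + (e (y - x)).snd := by
      refine ⟨convex_univ, fun y _ z _ a b ha hb hab => ?_⟩
      have h2 : a • y + b • z - x = a • (y - x) + b • (z - x) := by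
        rw [smul_sub, smul_sub, sub_add_sub_comm, ← add_smul, hab, one_smul]
      simp only [h2, map_add, map_smul, WithLp.add_fst, WithLp.smul_fst, WithLp.add_snd,
        WithLp.smul_snd, smul_eq_mul]
      have h3 := norm_add_le (a • (e (y - x)).fst) (b • (e (z - x)).fst)
      rw [norm_smul, norm_smul, Real.norm_of_nonneg ha, Real.norm_of_nonneg hb] at h3
      nlinarith [mul_le_mul_of_nonneg_left h3 K.2]
    simpa [hS] using h1.convex_lt 0
  have hup : ∀ t : ℝ, t < 0 → x + t • graphUp e ∈ S := fun t ht => by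
    simp [hS, graphUp, ht]
  have ht : Tendsto (fun t : ℝ => x + t • graphUp e) (𝓝[<] 0) (𝓝 x) := by
    have : Continuous fun t : ℝ => x + t • graphUp e := by fun_prop
    simpa using (this.tendsto 0).mono_left nhdsWithin_le_nhds
  have hxS : x ∈ closure S := mem_closure_of_tendsto ht
    (by filter_upwards [self_mem_nhdsWithin] with t ht using hup t ht)
  have hud : UniqueDiffWithinAt ℝ S x := uniqueDiffWithinAt_convex hSc
    (by rw [hSo.interior_eq]; exact ⟨_, hup (-1) (by norm_num)⟩) hxS
  have h2 := hud.inter (hU.mem_nhds hxU)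
  refine h2.mono fun y hy => subset_closure ((hch.mem_iff' hy.2).2 ?_)
  have hy1 : K * ‖(e (y - x)).fst‖ + (e (y - x)).snd < 0 := hy.1
  have h3 := hg.dist_le_mul (e x).fst (e y).fst
  rw [dist_comm, dist_comm (e x).fst, dist_eq_norm, dist_eq_norm, Real.norm_eq_abs] at h3
  rw [map_sub, WithLp.sub_fst, WithLp.sub_snd] at hy1
  have h4 := (abs_le.1 h3).1
  rw [graphHeight] at hh ⊢
  linarith

end

section

open MeasureTheory Measure Set Filter Function
open scoped NNReal ENNReal

/-! ### The divergence theorem on a partitioned domain -/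

variable {ι : Type*} {Ω : Set E3} {Ωp : ι → Set E3}

/-- Otherwise a neighbourhood of x would lie in the closure of `Ωp i`. But the open cone around the
outward normal misses `Ωp i` near x, hence also its closure. -/
theorem IsPartition.exists_ne_mem_frontier [Finite ι] (h : IsPartition Ω Ωp) {i : ι} {x n : E3}
    (hx : x ∈ Ω) (hn : IsOutwardNormal (Ωp i) x n) : ∃ j, j ≠ i ∧ x ∈ frontier (Ωp j) := by
  have hcl : ∃ j, j ≠ i ∧ x ∈ closure (Ωp j) := by
    by_contra! hne
    have h1 : ∀ᶠ y in 𝓝 x, ∀ j, j ≠ i → y ∉ closure (Ωp j) := by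
      rw [eventually_all]
      intro j
      by_cases hj : j = i
      · exact Eventually.of_forall fun y hj' => absurd hj hj'
      · filter_upwards [isClosed_closure.isOpen_compl.mem_nhds (hne j hj)] with y hy _ using hy
    have h2 : ∀ᶠ y in 𝓝 x, y ∈ closure (Ωp i) := by
      filter_upwards [h1, h.lipschitz.isOpen.mem_nhds hx] with y hy hyΩ
      obtain ⟨j, hj⟩ := mem_iUnion.1 (h.cover hyΩ)
      by_cases hji : j = i
      · exact hji ▸ hj
      · exact absurd hj (hy j hji)
    have h3 := hn.2.2 (1 / 2) (by norm_num)
    have ht : Tendsto (fun t : ℝ => x + t • n) (𝓝[>] 0) (𝓝 x) := by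
      have : Continuous fun t : ℝ => x + t • n := by fun_prop
      simpa using (this.tendsto 0).mono_left nhdsWithin_le_nhds
    have hO : IsOpen {y | 1 / 2 * ‖y - x‖ < inner ℝ n (y - x)} :=
      isOpen_lt (by fun_prop) (by fun_prop)
    obtain ⟨t, ⟨ht1, ht2⟩, ht0⟩ :=
      ((ht.eventually (h2.eventually_nhds.and h3.eventually_nhds)).and self_mem_nhdsWithin).exists
    have ht0 : 0 < t := ht0
    have htO : x + t • n ∈ {y | 1 / 2 * ‖y - x‖ < inner ℝ n (y - x)} := by
      simp only [mem_ofPred_eq, add_sub_cancel_left, norm_smul, inner_smul_right,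
        real_inner_self_eq_norm_sq, hn.2.1, Real.norm_of_nonneg ht0.le]
      linarith
    obtain ⟨z, ⟨hz1, hz2⟩, hz3⟩ := mem_closure_iff_nhds.1 ht1.self_of_nhds _
      (inter_mem (hO.mem_nhds htO) ht2)
    exact hz2.2 hz1 hz3
  obtain ⟨j, hj, hxj⟩ := hcl
  refine ⟨j, hj, ?_⟩
  rw [(h.lipschitz_piece j).isOpen.frontier_eq]
  refine ⟨hxj, fun hxj' => ?_⟩
  exact disjoint_left.1 ((h.disjoint j i hj).closure_right (h.lipschitz_piece j).isOpen) hxj'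
    (frontier_subset_closure hn.1)

/-- Where normals exist, an interface point belongs to exactly two subdomain boundaries: a second
one exists, and a third is excluded because three unit vectors cannot be pairwise opposite. The two
outward fluxes then cancel. -/
theorem IsPartition.sum_flux_eq_zero [Fintype ι] (h : IsPartition Ω Ωp)
    {V : ι → Fin 3 → E3 → ℝ}
    (hjump : ∀ i j, i ≠ j → ∀ x ∈ Ω, ∀ n : E3, IsOutwardNormal (Ωp i) x n →
      IsOutwardNormal (Ωp j) x (-n) → ∑ η, V i η x * n η = ∑ η, V j η x * n η)
    {x : E3} (hx : x ∈ Ω) (hn : ∀ i, x ∈ frontier (Ωp i) → ∃ n, IsOutwardNormal (Ωp i) x n) :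
    ∑ i, (frontier (Ωp i)).indicator
      (fun x => ∑ η, V i η x * outwardNormal (Ωp i) x η) x = 0 := by
  classical
  by_cases hex : ∃ i, x ∈ frontier (Ωp i)
  · obtain ⟨i, hi⟩ := hex
    obtain ⟨n, hni⟩ := hn i hi
    obtain ⟨j, hji, hj⟩ := h.exists_ne_mem_frontier hx hni
    obtain ⟨m, hnj⟩ := hn j hj
    have hm := hni.eq_neg_of_disjoint hnj (h.disjoint i j hji.symm)
    subst hm
    rw [← Finset.sum_subset (Finset.subset_univ {i, j}), Finset.sum_pair hji.symm,
      indicator_of_mem hi, indicator_of_mem hj, hni.outwardNormal_eq, hnj.outwardNormal_eq,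
      hjump i j hji.symm x hx n hni hnj, ← Finset.sum_add_distrib]
    · exact Finset.sum_eq_zero fun η _ => by simp
    · intro k _ hk
      refine indicator_of_notMem (fun hxk => ?_) _
      simp only [Finset.mem_insert, Finset.mem_singleton, not_or] at hk
      obtain ⟨l, hnk⟩ := hn k hxk
      have h1 := hni.eq_neg_of_disjoint hnk (h.disjoint i k (Ne.symm hk.1))
      have h2 := hnj.eq_neg_of_disjoint hnk (h.disjoint j k (Ne.symm hk.2))
      rw [neg_neg] at h2
      have h3 : inner ℝ n n = inner ℝ n (-n) := congrArg _ (h2.symm.trans h1)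
      rw [inner_neg_right, real_inner_self_eq_norm_sq, hni.2.1] at h3
      norm_num at h3
  · push Not at hex
    exact Finset.sum_eq_zero fun i _ => indicator_of_notMem (hex i) _

/-- Almost everywhere on the part of the outer boundary that belongs to a subdomain, the domain and
the subdomain have a common outward normal. -/
theorem IsPartition.ae_common_normal (h : IsPartition Ω Ωp) (i : ι) :
    ∀ᵐ x ∂(μHE[2].restrict (frontier Ω ∩ frontier (Ωp i))),
      IsOutwardNormal Ω x (outwardNormal Ω x) ∧ IsOutwardNormal (Ωp i) x (outwardNormal Ω x) ∧
        outwardNormal (Ωp i) x = outwardNormal Ω x := by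
  filter_upwards [ae_restrict_of_ae_restrict_of_subset inter_subset_left
      h.lipschitz.ae_exists_normal, ae_restrict_of_ae_restrict_of_subset inter_subset_right
      (h.lipschitz_piece i).ae_exists_normal] with x ⟨n, hn⟩ ⟨m, hm⟩
  have hmn := hm.eq_of_subset hn (h.subset i)
  subst hmn
  rw [hn.outwardNormal_eq, hm.outwardNormal_eq]
  exact ⟨hn, hm, rfl⟩

/-- The divergence theorem on a partitioned domain, for a piecewise smooth field whose normal
component is continuous across the interfaces. -/
theorem IsPartition.sum_integral_divergence [Fintype ι] (h : IsPartition Ω Ωp)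
    {V : ι → Fin 3 → E3 → ℝ} (hV1 : ∀ i η, ContDiffOn ℝ 1 (V i η) (Ωp i))
    (hVc : ∀ i η, ContinuousOn (V i η) (closure (Ωp i)))
    (hint : ∀ i, IntegrableOn (divergence (V i)) (Ωp i))
    (hjump : ∀ i j, i ≠ j → ∀ x ∈ Ω, ∀ n : E3, IsOutwardNormal (Ωp i) x n →
      IsOutwardNormal (Ωp j) x (-n) → ∑ η, V i η x * n η = ∑ η, V j η x * n η) :
    ∑ i, ∫ x in Ωp i, divergence (V i) x
      = ∑ i, ∫ x in frontier Ω ∩ frontier (Ωp i),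
          ∑ η, V i η x * outwardNormal Ω x η ∂μHE[2] := by
  set G : ι → E3 → ℝ := fun i x => ∑ η, V i η x * outwardNormal (Ωp i) x η with hG
  have hGi : ∀ i, IntegrableOn (G i) (frontier (Ωp i)) μHE[2] := fun i =>
    integrable_finsetSum _ fun η _ => (h.lipschitz_piece i).integrableOn_frontier (hVc i η) η
  have hΩm := h.lipschitz.isOpen.measurableSet
  have hsplit : ∀ i, ∫ x in frontier (Ωp i), G i x ∂μHE[2]
      = (∫ x in frontier (Ωp i) ∩ Ω, G i x ∂μHE[2])
        + ∫ x in frontier Ω ∩ frontier (Ωp i), G i x ∂μHE[2] := fun i => by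
    have hsd : frontier (Ωp i) \ Ω = frontier Ω ∩ frontier (Ωp i) := by
      rw [h.lipschitz.isOpen.frontier_eq]
      ext x
      constructor
      · rintro ⟨h1, h2⟩
        exact ⟨⟨closure_mono (h.subset i) (frontier_subset_closure h1), h2⟩, h1⟩
      · rintro ⟨⟨_, h2⟩, h1⟩
        exact ⟨h1, h2⟩
    rw [← hsd, integral_inter_add_sdiff hΩm (hGi i)]
  have hzero : ∑ i, ∫ x in frontier (Ωp i) ∩ Ω, G i x ∂μHE[2] = 0 := by
    have h1 : ∀ i, ∫ x in frontier (Ωp i) ∩ Ω, G i x ∂μHE[2]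
        = ∫ x in Ω, (frontier (Ωp i)).indicator (G i) x ∂μHE[2] := fun i => by
      rw [integral_indicator isClosed_frontier.measurableSet,
        Measure.restrict_restrict isClosed_frontier.measurableSet]
    simp_rw [h1]
    rw [← integral_finsetSum]
    · refine integral_eq_zero_of_ae ?_
      have h2 : ∀ᵐ x ∂(μHE[2] : Measure E3), ∀ i, x ∈ frontier (Ωp i) →
          ∃ n, IsOutwardNormal (Ωp i) x n := ae_all_iff.2 fun i =>
        (ae_restrict_iff' isClosed_frontier.measurableSet).1
          (h.lipschitz_piece i).ae_exists_normal
      filter_upwards [ae_restrict_of_ae h2, ae_restrict_mem hΩm] with x hx hxΩ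
      exact h.sum_flux_eq_zero hjump hxΩ hx
    · intro i _
      exact ((integrable_indicator_iff isClosed_frontier.measurableSet).2 (hGi i)).restrict
  calc ∑ i, ∫ x in Ωp i, divergence (V i) x
      = ∑ i, ∫ x in frontier (Ωp i), G i x ∂μHE[2] := Finset.sum_congr rfl fun i _ =>
        (h.lipschitz_piece i).integral_divergence (hV1 i) (hVc i) (hint i)
    _ = ∑ i, ∫ x in frontier Ω ∩ frontier (Ωp i), G i x ∂μHE[2] := by
        rw [Finset.sum_congr rfl fun i _ => hsplit i, Finset.sum_add_distrib, hzero, zero_add]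
    _ = _ := by
        refine Finset.sum_congr rfl fun i _ => integral_congr_ae ?_
        filter_upwards [h.ae_common_normal i] with x hx
        simp only [hG, hx.2.2]

end

section

open MeasureTheory Measure Set Filter Function
open scoped NNReal ENNReal ComplexConjugate

/-! ### Algebra of the stretching factors -/

theorem add_ofReal_ne_zero {s : ℂ} (hs : 0 < s.re) {t : ℝ} (ht : 0 ≤ t) : s + t ≠ 0 := fun h => by
  have := congrArg Complex.re h
  simp at this
  linarith

theorem one_add_div_eq {s : ℂ} (hs : s ≠ 0) (t : ℝ) : 1 + (t : ℂ) / s = (s + t) / s := by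
  field_simp

/-- The origin of k_η, with t = d_η. -/
theorem re_conj_mul_div {s : ℂ} (hs : 0 < s.re) {t : ℝ} (ht : 0 ≤ t) :
    (conj (s + t) * s / (s + t)).re = s.re + 2 * t * s.im ^ 2 / ‖s + t‖ ^ 2 := by
  have h0 : (s.re + t) ^ 2 + s.im ^ 2 ≠ 0 := by positivity
  have h0' : (s.re + t) * (s.re + t) + s.im * s.im ≠ 0 := by simpa only [sq] using h0
  rw [← Complex.normSq_eq_norm_sq, Complex.div_re]
  simp [Complex.normSq_apply]
  field_simp
  ring

/-- The origin of the weight in the boundary term, as Re(1/S_η). -/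
theorem re_one_div {s : ℂ} (hs : 0 < s.re) (t : ℝ) :
    (1 / (1 + (t : ℂ) / s)).re
      = (s.re * (s.re + t) + s.im ^ 2) / ((s.re + t) ^ 2 + s.im ^ 2) := by
  have hs0 : s ≠ 0 := fun h => by simp [h] at hs
  rw [one_add_div_eq hs0, one_div_div, Complex.div_re]
  simp [Complex.normSq_apply]
  rw [← add_div]
  congr 1 <;> ring

/-- Since Re s > 0 and t ≥ 0, |s + t|² ≥ |s|² + t². -/
theorem two_mul_norm_le {s : ℂ} (hs : 0 < s.re) {t : ℝ} (ht : 0 ≤ t) :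
    2 * (t * ‖s‖) ≤ ‖s + t‖ ^ 2 := by
  have h1 : ‖s + t‖ ^ 2 = ‖s‖ ^ 2 + 2 * (t * s.re) + t ^ 2 := by
    rw [← Complex.normSq_eq_norm_sq, ← Complex.normSq_eq_norm_sq]
    simp [Complex.normSq_apply]
    ring
  nlinarith [sq_nonneg (‖s‖ - t), mul_nonneg ht hs.le]

/-- The commutator term produced by a nonconstant damping function is controlled by the energy. -/
theorem norm_commutator_le {s p q : ℂ} (hs : 0 < s.re) {t t' κ ρ β : ℝ} (ht : 0 ≤ t) (hκ : 0 < κ)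
    (hρ : 0 < ρ) (hβ0 : 0 ≤ β) (hβ : √(κ / ρ) * |t'| ≤ β * t) :
    ‖p * t' / (ρ * s * (1 + t / s) ^ 2) * q‖ ≤ β * (1 / 4 * (‖q‖ ^ 2 / κ + ‖p‖ ^ 2 / ρ)) := by
  have hs0 : s ≠ 0 := fun h => by simp [h] at hs
  have hz := add_ofReal_ne_zero hs ht
  set c := √(κ / ρ) with hc
  have hc0 : 0 < c := Real.sqrt_pos.2 (by positivity)
  have hc2 : c ^ 2 = κ / ρ := Real.sq_sqrt (by positivity)
  have hzn : 0 < ‖s + t‖ := norm_pos_iff.2 hz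
  have hsn : 0 < ‖s‖ := norm_pos_iff.2 hs0
  have e1 : ‖p * t' / (ρ * s * (1 + t / s) ^ 2) * q‖
      = |t'| * ‖s‖ * (‖p‖ * ‖q‖) / (ρ * ‖s + t‖ ^ 2) := by
    rw [one_add_div_eq hs0]
    simp only [norm_mul, norm_div, norm_pow, Complex.norm_real, Real.norm_eq_abs, abs_of_pos hρ]
    field_simp
  have h1 : |t'| ≤ β * t / c := by rw [le_div_iff₀ hc0]; linarith
  have h2 : |t'| * ‖s‖ ≤ β / (2 * c) * ‖s + t‖ ^ 2 := by
    calc |t'| * ‖s‖ ≤ β * t / c * ‖s‖ := by gcongr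
      _ = β / (2 * c) * (2 * (t * ‖s‖)) := by field_simp
      _ ≤ _ := by gcongr; exact two_mul_norm_le hs ht
  rw [e1]
  -- The arithmetic-geometric mean inequality is applied to ‖q‖/c and ‖p‖, because ρc² = κ then
  -- produces the energy weights 1/κ and 1/ρ.
  calc |t'| * ‖s‖ * (‖p‖ * ‖q‖) / (ρ * ‖s + t‖ ^ 2)
      ≤ β / (2 * c) * ‖s + t‖ ^ 2 * (‖p‖ * ‖q‖) / (ρ * ‖s + t‖ ^ 2) := by gcongr
    _ = β * (1 / 4 * (2 * ((‖q‖ / c) * ‖p‖) / ρ)) := by field_simp; ring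
    _ ≤ β * (1 / 4 * (((‖q‖ / c) ^ 2 + ‖p‖ ^ 2) / ρ)) := by
        gcongr
        nlinarith [sq_nonneg (‖q‖ / c - ‖p‖)]
    _ = _ := by
        rw [div_pow, hc2]
        field_simp

/-! ### The energy flux and its divergence -/

/-- The real energy flux `Re ((Φ / (S_x S_y S_z) + f) conj (s u))`, where `Φ` is the flux of `u`. -/
def energyField (A : Set E3) (ρ : E3 → ℝ) (d : Fin 3 → ℝ → ℝ) (s : ℂ) (u : E3 → ℂ)
    (f : Fin 3 → E3 → ℂ) (η : Fin 3) (x : E3) : ℝ :=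
  ((flux A ρ d s u η x / Sprod d s x + f η x) * conj (s * u x)).re

variable {A : Set E3} {κ ρ : E3 → ℝ} {d : Fin 3 → ℝ → ℝ} {s : ℂ} {u F : E3 → ℂ}
  {f : Fin 3 → E3 → ℂ}

theorem ne_zero_of_re_pos (hs : 0 < s.re) : s ≠ 0 := fun h => by simp [h] at hs

theorem S_ne_zero (hs : 0 < s.re) (hd : ∀ η t, 0 ≤ d η t) (η : Fin 3) (x : E3) :
    S d s η x ≠ 0 := by
  rw [S, one_add_div_eq (ne_zero_of_re_pos hs)]
  exact div_ne_zero (add_ofReal_ne_zero hs (hd _ _)) (ne_zero_of_re_pos hs)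

theorem s_mul_S (hs : 0 < s.re) (η : Fin 3) (x : E3) : s * S d s η x = s + d η (x η) := by
  have := ne_zero_of_re_pos hs
  rw [S]
  field_simp

theorem Sprod_ne_zero (hs : 0 < s.re) (hd : ∀ η t, 0 ≤ d η t) (x : E3) : Sprod d s x ≠ 0 :=
  Finset.prod_ne_zero_iff.2 fun η _ => S_ne_zero hs hd η x

theorem Sprod_eq_mul (η : Fin 3) (x : E3) :
    Sprod d s x = S d s η x * ∏ ξ ∈ Finset.univ.erase η, S d s ξ x :=
  (Finset.mul_prod_erase _ _ (Finset.mem_univ η)).symm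

theorem continuous_S (hd : ∀ η, Continuous (d η)) (η : Fin 3) : Continuous (S d s η) := by
  have := hd η
  unfold S
  fun_prop

theorem continuous_Sprod (hd : ∀ η, Continuous (d η)) : Continuous (Sprod d s) :=
  continuous_finsetProd _ fun η _ => continuous_S hd η

theorem contDiffAt_S {x : E3} (hd : ∀ η, ContDiffAt ℝ 1 (d η) (x η)) (η : Fin 3) :
    ContDiffAt ℝ 1 (S d s η) x := by
  have h1 : ContDiffAt ℝ 1 (fun x : E3 => x η) x := by fun_prop
  have h2 : ContDiffAt ℝ 1 (fun x : E3 => (d η (x η) : ℂ)) x :=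
    Complex.ofRealCLM.contDiff.contDiffAt.comp x ((hd η).comp x h1)
  exact contDiffAt_const.add (h2.div_const s)

theorem contDiffAt_Sprod {x : E3} (hd : ∀ η, ContDiffAt ℝ 1 (d η) (x η)) :
    ContDiffAt ℝ 1 (Sprod d s) x :=
  contDiffAt_prod fun η _ => contDiffAt_S hd η

/-- Along the coordinate η only the factor S_η varies, as each damping function depends on its own
coordinate. -/
theorem hasLineDerivAt_Sprod {x : E3} (hd : ∀ η, ContDiffAt ℝ 1 (d η) (x η)) (η : Fin 3) :
    HasLineDerivAt ℝ (Sprod d s)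
      (((deriv (d η) (x η) : ℝ) : ℂ) / s * ∏ ξ ∈ Finset.univ.erase η, S d s ξ x) x
      (EuclideanSpace.single η 1) := by
  have h1 : (fun t : ℝ => Sprod d s (x + t • EuclideanSpace.single η (1 : ℝ)))
      = fun t => (1 + (d η (x η + t) : ℂ) / s) * ∏ ξ ∈ Finset.univ.erase η, S d s ξ x := by
    funext t
    rw [Sprod_eq_mul η]
    congr 1
    · simp [S]
    · refine Finset.prod_congr rfl fun ξ hξ => ?_
      have : ξ ≠ η := (Finset.mem_erase.1 hξ).1
      simp [S, this]
  unfold HasLineDerivAt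
  rw [h1]
  refine HasDerivAt.mul_const ?_ _
  have h2 : HasDerivAt (fun t : ℝ => d η (x η + t)) (deriv (d η) (x η)) 0 := by
    have h3 : HasDerivAt (d η) (deriv (d η) (x η)) (x η + 0) := by
      rw [add_zero]
      exact ((hd η).differentiableAt one_ne_zero).hasDerivAt
    simpa using h3.comp_const_add (x η) 0
  exact (h2.ofReal_comp.div_const s).const_add 1

theorem hasLineDerivAt_pderivWithin {B : Set E3} {h : E3 → ℂ} {x : E3} (hB : B ∈ 𝓝 x)
    (hh : ContDiffOn ℝ 1 h B) (η : Fin 3) :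
    HasLineDerivAt ℝ h (pderivWithin B η h x) x (EuclideanSpace.single η 1) := by
  rw [pderivWithin, fderivWithin_of_mem_nhds hB]
  exact ((hh.contDiffAt hB).differentiableAt one_ne_zero).hasFDerivAt.hasLineDerivAt _

theorem contDiffOn_energyField (hA : IsOpen A) (hs : 0 < s.re) (hd0 : ∀ η t, 0 ≤ d η t)
    (hd : ∀ x ∈ A, ∀ η, ContDiffAt ℝ 1 (d η) (x η))
    (hu : ContDiffOn ℝ 1 u (closure A)) (hΦ : ∀ η, ContDiffOn ℝ 1 (flux A ρ d s u η) A)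
    (hf : ∀ η, ContDiffOn ℝ 1 (f η) A) (η : Fin 3) :
    ContDiffOn ℝ 1 (energyField A ρ d s u f η) A := by
  intro x hx
  have h1 := (hΦ η).contDiffAt (hA.mem_nhds hx)
  have h2 := (hf η).contDiffAt (hA.mem_nhds hx)
  have h3 := (hu.mono subset_closure).contDiffAt (hA.mem_nhds hx)
  have h4 : ContDiffAt ℝ 1 (fun x => flux A ρ d s u η x / Sprod d s x) x := by
    simp only [div_eq_mul_inv]
    exact h1.mul ((contDiffAt_Sprod (hd x hx)).inv (Sprod_ne_zero hs hd0 x))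
  have h5 : ContDiffAt ℝ 1 (fun x => conj (s * u x)) x :=
    Complex.conjCLE.contDiff.contDiffAt.comp x (contDiffAt_const.mul h3)
  exact (Complex.reCLM.contDiff.contDiffAt.comp x ((h4.add h2).mul h5)).contDiffWithinAt

theorem continuousOn_stretchedGrad (hA : IsLipschitzDomain A) (hs : 0 < s.re)
    (hd0 : ∀ η t, 0 ≤ d η t) (hdc : ∀ η, Continuous (d η)) (hu : ContDiffOn ℝ 1 u (closure A))
    (η : Fin 3) : ContinuousOn (stretchedGrad A d s u η) (closure A) := by
  refine ContinuousOn.mul ?_ ?_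
  · exact (continuous_const.div (continuous_S hdc η) fun x => S_ne_zero hs hd0 η x).continuousOn
  · exact (hu.continuousOn_fderivWithin hA.uniqueDiffOn_closure le_rfl).clm_apply
      continuousOn_const

theorem continuousOn_flux (hA : IsLipschitzDomain A) (hs : 0 < s.re)
    (hd0 : ∀ η t, 0 ≤ d η t) (hdc : ∀ η, Continuous (d η)) (hu : ContDiffOn ℝ 1 u (closure A))
    (hρc : ContinuousOn ρ (closure A)) (hρ : ∀ x ∈ closure A, 0 < ρ x) (η : Fin 3) :
    ContinuousOn (flux A ρ d s u η) (closure A) := by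
  refine ContinuousOn.mul (ContinuousOn.mul ?_ ?_)
    (continuousOn_stretchedGrad hA hs hd0 hdc hu η)
  · exact (continuous_finsetProd _ fun ξ _ => continuous_S hdc ξ).continuousOn
  · exact continuousOn_const.div (Complex.continuous_ofReal.comp_continuousOn hρc)
      fun x hx => by exact_mod_cast (hρ x hx).ne'

theorem continuousOn_energyField (hA : IsLipschitzDomain A) (hs : 0 < s.re)
    (hd0 : ∀ η t, 0 ≤ d η t) (hdc : ∀ η, Continuous (d η)) (hu : ContDiffOn ℝ 1 u (closure A))
    (hρc : ContinuousOn ρ (closure A)) (hρ : ∀ x ∈ closure A, 0 < ρ x)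
    (hf : ∀ η, ContinuousOn (f η) (closure A)) (η : Fin 3) :
    ContinuousOn (energyField A ρ d s u f η) (closure A) := by
  refine Complex.continuous_re.comp_continuousOn (ContinuousOn.mul (ContinuousOn.add ?_ (hf η)) ?_)
  · exact (continuousOn_flux hA hs hd0 hdc hu hρc hρ η).div (continuous_Sprod hdc).continuousOn
      fun x _ => Sprod_ne_zero hs hd0 x
  · exact Complex.continuous_conj.comp_continuousOn (continuousOn_const.mul hu.continuousOn)

theorem flux_div_Sprod (hs : 0 < s.re) (hd0 : ∀ η t, 0 ≤ d η t) (η : Fin 3) (x : E3) :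
    flux A ρ d s u η x / Sprod d s x = stretchedGrad A d s u η x / (ρ x * S d s η x) := by
  have h1 : ∏ ξ ∈ Finset.univ.erase η, S d s ξ x ≠ 0 :=
    Finset.prod_ne_zero_iff.2 fun ξ _ => S_ne_zero hs hd0 ξ x
  have h2 := S_ne_zero hs hd0 η x
  rw [flux, Sprod_eq_mul η]
  field_simp

theorem pderivWithin_eq_S_mul (hs : 0 < s.re) (hd0 : ∀ η t, 0 ≤ d η t) (η : Fin 3) (x : E3) :
    pderivWithin (closure A) η u x = S d s η x * stretchedGrad A d s u η x := by
  have h2 := S_ne_zero hs hd0 η x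
  rw [stretchedGrad]
  field_simp

/-- Product rule, with three groups: derivatives of the flux and of f, which the equation controls;
the commutator from differentiating 1/(S_xS_yS_z); and the derivative falling on conj(su). -/
theorem fderiv_energyField (hA : IsOpen A) (hs : 0 < s.re) (hd0 : ∀ η t, 0 ≤ d η t)
    (hd : ∀ x ∈ A, ∀ η, ContDiffAt ℝ 1 (d η) (x η))
    (hu : ContDiffOn ℝ 1 u (closure A)) (hΦ : ∀ η, ContDiffOn ℝ 1 (flux A ρ d s u η) A)
    (hf : ∀ η, ContDiffOn ℝ 1 (f η) A) {x : E3} (hx : x ∈ A) (η : Fin 3) :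
    fderiv ℝ (energyField A ρ d s u f η) x (EuclideanSpace.single η 1)
      = ((pderivWithin A η (flux A ρ d s u η) x / Sprod d s x + pderivWithin A η (f η) x)
            * conj (s * u x)
          - stretchedGrad A d s u η x * deriv (d η) (x η) / (ρ x * s * S d s η x ^ 2)
            * conj (s * u x)
          + (stretchedGrad A d s u η x / (ρ x * S d s η x) + f η x)
            * conj (s * S d s η x * stretchedGrad A d s u η x)).re := by
  have hAx := hA.mem_nhds hx
  have h0 := Sprod_ne_zero hs hd0 x
  have hs0 := ne_zero_of_re_pos hs
  have h1 := hasLineDerivAt_pderivWithin hAx (hΦ η) η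
  have h2 := hasLineDerivAt_pderivWithin hAx (hf η) η
  have h3 := hasLineDerivAt_pderivWithin (mem_of_superset hAx subset_closure) hu η
  have h4 := hasLineDerivAt_Sprod (s := s) (hd x hx) η
  unfold HasLineDerivAt at h1 h2 h3 h4
  have hx0 : x + (0 : ℝ) • EuclideanSpace.single η (1 : ℝ) = x := by simp
  have h5 := ((h1.div h4 (by rw [hx0]; exact h0)).add h2).mul
    (Complex.conjCLE.toContinuousLinearMap.hasFDerivAt.comp_hasDerivAt (0 : ℝ) (h3.const_mul s))
  have h6 := Complex.reCLM.hasFDerivAt.comp_hasDerivAt (0 : ℝ) h5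
  have h7 : HasLineDerivAt ℝ (energyField A ρ d s u f η) _ x (EuclideanSpace.single η 1) := h6
  have hdiff := ((contDiffOn_energyField hA hs hd0 hd hu hΦ hf η).contDiffAt hAx).differentiableAt
    one_ne_zero
  rw [← hdiff.lineDeriv_eq_fderiv, h7.lineDeriv]
  have hP : ∏ ξ ∈ Finset.univ.erase η, S d s ξ x ≠ 0 :=
    Finset.prod_ne_zero_iff.2 fun ξ _ => S_ne_zero hs hd0 ξ x
  have hSη := S_ne_zero hs hd0 η x
  have hΦe := flux_div_Sprod (A := A) (ρ := ρ) (u := u) hs hd0 η x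
  have hkey : flux A ρ d s u η x * (((deriv (d η) (x η) : ℝ) : ℂ) / s
        * ∏ ξ ∈ Finset.univ.erase η, S d s ξ x) / Sprod d s x ^ 2
      = stretchedGrad A d s u η x * deriv (d η) (x η) / (ρ x * s * S d s η x ^ 2) := by
    rw [flux, Sprod_eq_mul η]
    field_simp
  simp only [hx0, Complex.reCLM_apply, Function.comp_apply, ContinuousLinearEquiv.coe_coe,
    Complex.conjCLE_apply]
  have hq : ∀ a : ℂ, (a * Sprod d s x) / Sprod d s x ^ 2 = a / Sprod d s x := fun a => by
    field_simp
  congr 1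
  simp only [Pi.add_apply, Pi.div_apply, hx0]
  rw [sub_div, hq, hkey, hΦe, pderivWithin_eq_S_mul hs hd0, ← mul_assoc s]
  ring

/-- The energy density `|s u|² / κ + ∑_η |(1/S_η) ∂u/∂η|² / ρ`. -/
def energyDensity (A : Set E3) (κ ρ : E3 → ℝ) (d : Fin 3 → ℝ → ℝ) (s : ℂ) (u : E3 → ℂ)
    (x : E3) : ℝ :=
  1 / κ x * ‖s * u x‖ ^ 2 + ∑ η, 1 / ρ x * ‖stretchedGrad A d s u η x‖ ^ 2

/-- The additional damping density `∑_η k_η |(1/S_η) ∂u/∂η|² / ρ`. -/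
def dampingDensity (A : Set E3) (ρ : E3 → ℝ) (d : Fin 3 → ℝ → ℝ) (s : ℂ) (u : E3 → ℂ)
    (x : E3) : ℝ :=
  ∑ η, kcoef d s η x / ρ x * ‖stretchedGrad A d s u η x‖ ^ 2

/-- The density bounding the work of the forcing data. -/
def workDensity (A : Set E3) (κ : E3 → ℝ) (d : Fin 3 → ℝ → ℝ) (s : ℂ) (u F : E3 → ℂ)
    (f : Fin 3 → E3 → ℂ) (x : E3) : ℝ :=
  1 / κ x * (‖F x‖ * ‖s * u x‖)
    + ∑ η, ‖s * S d s η x * f η x‖ * ‖stretchedGrad A d s u η x‖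

/-- The product equals |p|²/r times conj(z)s/z with z = s + d_η, so `re_conj_mul_div` applies. -/
theorem re_stretchedGrad_term (hs : 0 < s.re) (hd0 : ∀ η t, 0 ≤ d η t) (p : ℂ) {r : ℝ}
    (η : Fin 3) (x : E3) :
    (p / (r * S d s η x) * conj (s * S d s η x * p)).re
      = s.re * (1 / r * ‖p‖ ^ 2) + kcoef d s η x / r * ‖p‖ ^ 2 := by
  have hs0 := ne_zero_of_re_pos hs
  have hz := add_ofReal_ne_zero hs (hd0 η (x η))
  have h1 := re_conj_mul_div hs (hd0 η (x η))
  have h2 : p / (r * S d s η x) * conj (s * S d s η x * p)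
      = ((1 / r * ‖p‖ ^ 2 : ℝ) : ℂ) * (conj (s + d η (x η)) * s / (s + d η (x η))) := by
    rw [s_mul_S hs, S, one_add_div_eq hs0, map_mul]
    push_cast
    rw [← Complex.mul_conj' p]
    rcases eq_or_ne (r : ℂ) 0 with hr | hr
    · simp [hr]
    · field_simp
  rw [h2, Complex.re_ofReal_mul, h1, kcoef, s_mul_S hs]
  ring

/-- The pointwise energy balance. The lower bound yields the estimate; the two-sided form also
yields integrability of the divergence. -/
theorem abs_divergence_energyField_sub_le (hA : IsOpen A) (hs : 0 < s.re)
    (hd0 : ∀ η t, 0 ≤ d η t) (hd : ∀ x ∈ A, ∀ η, ContDiffAt ℝ 1 (d η) (x η))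
    (hu : ContDiffOn ℝ 1 u (closure A)) (hΦ : ∀ η, ContDiffOn ℝ 1 (flux A ρ d s u η) A)
    (hf : ∀ η, ContDiffOn ℝ 1 (f η) A) {x : E3} (hx : x ∈ A) (hκ : 0 < κ x) (hρ : 0 < ρ x)
    {β : ℝ} (hβ0 : 0 ≤ β)
    (hβ : ∀ η, √(κ x / ρ x) * |deriv (d η) (x η)| ≤ β * d η (x η))
    (heq : s ^ 2 * Sprod d s x / (κ x : ℂ) * u x
        - ∑ η, pderivWithin A η (flux A ρ d s u η) x
      = Sprod d s x / (κ x : ℂ) * F x + Sprod d s x * ∑ η, pderivWithin A η (f η) x) :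
    |divergence (energyField A ρ d s u f) x
        - (s.re * energyDensity A κ ρ d s u x + dampingDensity A ρ d s u x)|
      ≤ β * energyDensity A κ ρ d s u x + workDensity A κ d s u F f x := by
  have hP := Sprod_ne_zero hs hd0 x
  have hκc : (κ x : ℂ) ≠ 0 := by exact_mod_cast hκ.ne'
  have heq' : ∑ η, (pderivWithin A η (flux A ρ d s u η) x / Sprod d s x
      + pderivWithin A η (f η) x) = s ^ 2 / κ x * u x - F x / κ x := by
    rw [Finset.sum_add_distrib, ← Finset.sum_div]
    field_simp
    field_simp at heq
    linear_combination -heq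
  set p := fun η => stretchedGrad A d s u η x with hp
  set T : Fin 3 → ℂ := fun η => p η * deriv (d η) (x η) / (ρ x * s * S d s η x ^ 2)
    * conj (s * u x) with hT
  have h1 : divergence (energyField A ρ d s u f) x
      = ((s ^ 2 / κ x * u x) * conj (s * u x)).re
        + ∑ η, (p η / (ρ x * S d s η x) * conj (s * S d s η x * p η)).re
        + (-(F x / κ x * conj (s * u x)) - ∑ η, T η
          + ∑ η, f η x * conj (s * S d s η x * p η)).re := by
    unfold divergence
    rw [Finset.sum_congr rfl fun η _ => fderiv_energyField hA hs hd0 hd hu hΦ hf hx η,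
      ← Complex.re_sum, ← Complex.re_sum, ← Complex.add_re, ← Complex.add_re]
    congr 1
    rw [Finset.sum_add_distrib, Finset.sum_sub_distrib, ← Finset.sum_mul, heq']
    simp only [add_mul, Finset.sum_add_distrib, hT, hp]
    ring
  have h2 : ((s ^ 2 / κ x * u x) * conj (s * u x)).re = s.re * (1 / κ x * ‖s * u x‖ ^ 2) := by
    have : (s ^ 2 / κ x * u x) * conj (s * u x) = ((1 / κ x * ‖s * u x‖ ^ 2 : ℝ) : ℂ) * s := by
      push_cast
      rw [← Complex.ofReal_pow ‖s * u x‖, ← Complex.normSq_eq_norm_sq, Complex.normSq_eq_conj_mul_self]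
      ring
    rw [this, Complex.re_ofReal_mul]
    ring
  have h3 : ∀ η, ‖T η‖ ≤ β * (1 / 4 * (1 / κ x * ‖s * u x‖ ^ 2 + 1 / ρ x * ‖p η‖ ^ 2)) :=
    fun η => by
      have := norm_commutator_le (p := p η) (q := conj (s * u x)) hs (hd0 η (x η)) hκ hρ hβ0 (hβ η)
      rw [RCLike.norm_conj] at this
      refine this.trans_eq ?_
      ring
  have h4 : ‖∑ η, T η‖ ≤ β * energyDensity A κ ρ d s u x := by
    refine (norm_sum_le_of_le _ fun η _ => h3 η).trans ?_
    rw [← Finset.mul_sum, energyDensity]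
    gcongr
    -- Each of the three commutators contributes a quarter of |su|²/κ, and three quarters is at most
    -- one.
    simp only [Fin.sum_univ_three]
    have hq : 0 ≤ 1 / κ x * ‖s * u x‖ ^ 2 := by positivity
    have hr : ∀ η, 0 ≤ 1 / ρ x * ‖p η‖ ^ 2 := fun η => by positivity
    linarith [hr 0, hr 1, hr 2]
  rw [h1, h2, Finset.sum_congr rfl fun η _ => re_stretchedGrad_term hs hd0 (p η) η x,
    Finset.sum_add_distrib, ← Finset.mul_sum]
  have h5 : ∀ D : ℝ, s.re * (1 / κ x * ‖s * u x‖ ^ 2) + (s.re * ∑ η, 1 / ρ x * ‖p η‖ ^ 2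
        + ∑ η, kcoef d s η x / ρ x * ‖p η‖ ^ 2) + D
      - (s.re * energyDensity A κ ρ d s u x + dampingDensity A ρ d s u x) = D := fun D => by
    rw [energyDensity, dampingDensity]
    ring
  rw [h5]
  refine (Complex.abs_re_le_norm _).trans ((norm_add_le _ _).trans ?_)
  have h6 := norm_sub_le (-(F x / κ x * conj (s * u x))) (∑ η, T η)
  have h7 : ‖-(F x / κ x * conj (s * u x))‖ = 1 / κ x * (‖F x‖ * ‖s * u x‖) := by
    rw [norm_neg, norm_mul, norm_div, RCLike.norm_conj, Complex.norm_real, Real.norm_of_nonneg hκ.le]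
    ring
  have h8 : ‖∑ η, f η x * conj (s * S d s η x * p η)‖
      ≤ ∑ η, ‖s * S d s η x * f η x‖ * ‖p η‖ := by
    refine norm_sum_le_of_le _ fun η _ => le_of_eq ?_
    rw [norm_mul, RCLike.norm_conj, norm_mul (s * S d s η x), norm_mul (s * S d s η x)]
    ring
  rw [workDensity]
  linarith

/-- Young's inequality for the work of the forcing data. -/
theorem workDensity_le {x : E3} (hκ : 0 < κ x) (hρ : 0 < ρ x) {l : ℝ} (hl : 0 < l) :
    workDensity A κ d s u F f x ≤ l / 2 * energyDensity A κ ρ d s u x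
      + 1 / (2 * l) * (1 / κ x * ‖F x‖ ^ 2 + ∑ η, ρ x * ‖s * S d s η x * f η x‖ ^ 2) := by
  have key : ∀ {m a b : ℝ}, 0 < m → a * b ≤ l / 2 * (1 / m * b ^ 2) + 1 / (2 * l) * (m * a ^ 2) := by
    intro m a b hm
    have h1 : l / 2 * (1 / m * b ^ 2) + 1 / (2 * l) * (m * a ^ 2) - a * b
        = (l * b - m * a) ^ 2 / (2 * l * m) := by
      field_simp
      ring
    have h2 : 0 ≤ (l * b - m * a) ^ 2 / (2 * l * m) := by positivity
    linarith
  have h1 : 1 / κ x * (‖F x‖ * ‖s * u x‖)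
      ≤ l / 2 * (1 / κ x * ‖s * u x‖ ^ 2) + 1 / (2 * l) * (1 / κ x * ‖F x‖ ^ 2) := by
    have h2 := key (a := ‖F x‖) (b := ‖s * u x‖) one_pos
    calc 1 / κ x * (‖F x‖ * ‖s * u x‖)
        ≤ 1 / κ x * (l / 2 * (1 / 1 * ‖s * u x‖ ^ 2) + 1 / (2 * l) * (1 * ‖F x‖ ^ 2)) := by gcongr
      _ = _ := by ring
  have h2 : ∑ η, ‖s * S d s η x * f η x‖ * ‖stretchedGrad A d s u η x‖
      ≤ ∑ η, (l / 2 * (1 / ρ x * ‖stretchedGrad A d s u η x‖ ^ 2)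
        + 1 / (2 * l) * (ρ x * ‖s * S d s η x * f η x‖ ^ 2)) :=
    Finset.sum_le_sum fun η _ => key hρ
  rw [workDensity, energyDensity]
  simp only [Fin.sum_univ_three] at h2 ⊢
  linarith

end

section

open MeasureTheory Measure Set Filter Function
open scoped NNReal ENNReal ComplexConjugate

/-! ### The boundary term -/

variable {A Ω : Set E3} {κ ρ : E3 → ℝ} {d : Fin 3 → ℝ → ℝ} {r : ℝ} {s : ℂ} {u F : E3 → ℂ}
  {f : Fin 3 → E3 → ℂ}

theorem sum_energyField_mul (x n : E3) :
    ∑ η, energyField A ρ d s u f η x * n η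
      = (((∑ η, flux A ρ d s u η x * (n η : ℂ)) / Sprod d s x + ∑ η, f η x * (n η : ℂ))
          * conj (s * u x)).re := by
  have h1 : ∀ η, energyField A ρ d s u f η x * n η
      = ((flux A ρ d s u η x / Sprod d s x + f η x) * conj (s * u x) * (n η : ℂ)).re :=
    fun η => (Complex.re_mul_ofReal _ _).symm
  rw [Finset.sum_congr rfl fun η _ => h1 η, ← Complex.re_sum]
  congr 1
  rw [Finset.sum_div, ← Finset.sum_add_distrib, Finset.sum_mul]
  refine Finset.sum_congr rfl fun η _ => ?_
  ring

theorem re_sum_sq_div_S (hs : 0 < s.re) (x n : E3) :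
    (∑ η, (n η : ℂ) ^ 2 / S d s η x).re
      = ∑ η, (s.re * (s.re + d η (x η)) + s.im ^ 2) / ((s.re + d η (x η)) ^ 2 + s.im ^ 2)
        * n η ^ 2 := by
  rw [Complex.re_sum]
  refine Finset.sum_congr rfl fun η _ => ?_
  rw [← re_one_div hs, ← Complex.re_mul_ofReal]
  congr 1
  rw [S]
  push_cast
  ring

theorem boundary_weight_pos (hs : 0 < s.re) (hd0 : ∀ η t, 0 ≤ d η t) (η : Fin 3) (x : E3) :
    0 < (s.re * (s.re + d η (x η)) + s.im ^ 2) / ((s.re + d η (x η)) ^ 2 + s.im ^ 2) := by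
  have := hd0 η (x η)
  positivity

theorem boundaryIntegrand_nonneg (hs : 0 < s.re) (hd0 : ∀ η t, 0 ≤ d η t) (hr : |r| ≤ 1)
    (x : E3) : 0 ≤ boundaryIntegrand Ω κ ρ d r s u x := by
  obtain ⟨h1, h2⟩ := abs_le.1 hr
  -- This includes r = -1, where the quotient is 0 by convention.
  have h3 : 0 ≤ (1 - r) / (1 + r) := div_nonneg (by linarith) (by linarith)
  have h4 : 0 ≤ ∑ η, (s.re * (s.re + d η (x η)) + s.im ^ 2)
      / ((s.re + d η (x η)) ^ 2 + s.im ^ 2) * outwardNormal Ω x η ^ 2 :=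
    Finset.sum_nonneg fun η _ => mul_nonneg (boundary_weight_pos hs hd0 η x).le (sq_nonneg _)
  unfold boundaryIntegrand
  positivity

/-- The outward energy flux determined by the boundary condition. -/
theorem sum_energyField_mul_eq_neg_boundaryIntegrand (hs : 0 < s.re) (hd0 : ∀ η t, 0 ≤ d η t)
    {x : E3} (hκ : 0 < κ x) (hρ : 0 < ρ x) (hn : IsOutwardNormal Ω x (outwardNormal Ω x))
    (hbc : Sprod d s x *
      ((1 - (r : ℂ)) / 2 * (√(κ x / ρ x) : ℂ)
          * (∑ η, (outwardNormal Ω x η : ℂ) ^ 2 / S d s η x) * (s * u x)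
        + ((r : ℂ) + 1) / 2 * (1 / (ρ x : ℂ))
          * ∑ η, (outwardNormal Ω x η : ℂ) / S d s η x ^ 2
            * pderivWithin (closure A) η u x) = 0)
    (hf : r ≠ -1 → ∑ η, f η x * (outwardNormal Ω x η : ℂ) = 0) :
    ∑ η, energyField A ρ d s u f η x * outwardNormal Ω x η
      = -boundaryIntegrand Ω κ ρ d r s u x := by
  have hP := Sprod_ne_zero hs hd0 x
  have hbc' := (mul_eq_zero.1 hbc).resolve_left hP
  rw [sum_energyField_mul]
  -- For r = -1 the condition reads c(∑ n_η²/S_η)su = 0. The real part of the sum is positive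
  -- because n is a unit vector, so su = 0 and both sides vanish, whatever f·n is. For other r the
  -- condition is solved for the normal flux.
  by_cases hr : r = -1
  · subst hr
    have hn0 : (∑ η, (outwardNormal Ω x η : ℂ) ^ 2 / S d s η x) ≠ 0 := fun h0 => by
      have h1 := re_sum_sq_div_S (d := d) hs x (outwardNormal Ω x)
      rw [h0, Complex.zero_re] at h1
      have h2 : ∀ η, outwardNormal Ω x η = 0 := fun η => by
        have h3 := (Finset.sum_eq_zero_iff_of_nonneg fun η _ =>
          mul_nonneg (boundary_weight_pos hs hd0 η x).le (sq_nonneg _)).1 h1.symm η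
            (Finset.mem_univ η)
        exact pow_eq_zero_iff two_ne_zero |>.1
          ((mul_eq_zero.1 h3).resolve_left (boundary_weight_pos hs hd0 η x).ne')
      have h4 := hn.2.1
      have h5 : outwardNormal Ω x = 0 := by
        ext η
        exact h2 η
      rw [h5, norm_zero] at h4
      exact zero_ne_one h4
    have hc0 : (√(κ x / ρ x) : ℂ) ≠ 0 := by
      exact_mod_cast (Real.sqrt_pos.2 (div_pos hκ hρ)).ne'
    have hsu : s * u x = 0 := by
      have h6 : (√(κ x / ρ x) : ℂ) * (∑ η, (outwardNormal Ω x η : ℂ) ^ 2 / S d s η x)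
          * (s * u x) = 0 := by
        push_cast at hbc'
        linear_combination hbc'
      exact (mul_eq_zero.1 h6).resolve_left (mul_ne_zero hc0 hn0)
    rw [boundaryIntegrand, hsu]
    simp
  · have hr1 : (1 + (r : ℂ)) ≠ 0 := fun h => hr (by
      have : (1 + r : ℝ) = 0 := by exact_mod_cast h
      linarith)
    have hflux : (∑ η, flux A ρ d s u η x * (outwardNormal Ω x η : ℂ)) / Sprod d s x
        = 1 / (ρ x : ℂ) * ∑ η, (outwardNormal Ω x η : ℂ) / S d s η x ^ 2
            * pderivWithin (closure A) η u x := by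
      rw [Finset.sum_div, Finset.mul_sum]
      refine Finset.sum_congr rfl fun η _ => ?_
      have hS := S_ne_zero hs hd0 η x
      rw [mul_div_right_comm, flux_div_Sprod hs hd0, pderivWithin_eq_S_mul hs hd0]
      field_simp
    have hval : (∑ η, flux A ρ d s u η x * (outwardNormal Ω x η : ℂ)) / Sprod d s x
        = -(((1 - r) / (1 + r) * √(κ x / ρ x) : ℝ) : ℂ)
            * (∑ η, (outwardNormal Ω x η : ℂ) ^ 2 / S d s η x) * (s * u x) := by
      rw [hflux]
      push_cast
      field_simp
      field_simp at hbc'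
      linear_combination hbc'
    rw [hval, hf hr, add_zero, mul_assoc, Complex.mul_conj, neg_mul, neg_mul, Complex.neg_re,
      mul_assoc, Complex.re_ofReal_mul, Complex.re_mul_ofReal, re_sum_sq_div_S hs,
      Complex.normSq_eq_norm_sq, boundaryIntegrand]
    ring

/-! ### Integrability of the densities -/

theorem integrableOn_of_continuousOn_closure (hA : IsLipschitzDomain A) {w : E3 → ℝ}
    (hw : ContinuousOn w (closure A)) : IntegrableOn w A :=
  (hw.integrableOn_compact hA.isCompact_closure).mono_set subset_closure

theorem continuous_kcoef (hs : 0 < s.re) (hd0 : ∀ η t, 0 ≤ d η t) (hdc : ∀ η, Continuous (d η))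
    (η : Fin 3) : Continuous (kcoef d s η) := by
  have h1 := hdc η
  have h2 := continuous_S (s := s) hdc η
  unfold kcoef
  refine Continuous.div (by fun_prop) (by fun_prop) fun x => ?_
  have := mul_ne_zero (ne_zero_of_re_pos hs) (S_ne_zero hs hd0 η x)
  positivity

theorem integrableOn_mul_norm_sq (hA : IsLipschitzDomain A) {w : E3 → ℝ} {h : E3 → ℂ}
    (hw : ContinuousOn w (closure A)) (hh : ContinuousOn h (closure A)) :
    IntegrableOn (fun x => w x * ‖h x‖ ^ 2) A :=
  integrableOn_of_continuousOn_closure hA (hw.mul (hh.norm.pow 2))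

theorem integrableOn_mul_norm_sq_of_memLp (hA : IsLipschitzDomain A) {w : E3 → ℝ}
    (hw : ContinuousOn w (closure A)) (hF : MemLp F 2 (volume.restrict A)) :
    IntegrableOn (fun x => w x * ‖F x‖ ^ 2) A := by
  obtain ⟨M, hM⟩ := hA.isCompact_closure.exists_bound_of_continuousOn hw
  refine Integrable.bdd_mul (c := M) (hF.integrable_norm_pow two_ne_zero)
    ((hw.mono subset_closure).aestronglyMeasurable hA.isOpen.measurableSet) ?_
  filter_upwards [ae_restrict_mem hA.isOpen.measurableSet] with x hx using hM x (subset_closure hx)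

/-- For X > 0 the hypothesis says that P l² - 2X l + Q ≥ 0 for l > 0, while for l ≤ 0 this is clear;
hence the discriminant is nonpositive. This plays the role of Cauchy–Schwarz for all subdomains and
components at once. -/
theorem le_sqrt_mul_sqrt {X P Q : ℝ} (hP : 0 ≤ P) (hQ : 0 ≤ Q)
    (h : ∀ l : ℝ, 0 < l → X ≤ l / 2 * P + 1 / (2 * l) * Q) : X ≤ √P * √Q := by
  rcases le_or_gt X 0 with hX | hX
  · exact hX.trans (by positivity)
  rw [← Real.sqrt_mul hP]
  refine Real.le_sqrt_of_sq_le ?_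
  have hd : discrim P (-2 * X) Q ≤ 0 := by
    refine discrim_le_zero fun l => ?_
    rcases le_or_gt l 0 with hl | hl
    · nlinarith [mul_nonneg hP (mul_self_nonneg l), mul_nonneg hX.le (neg_nonneg.2 hl)]
    · have h1 := mul_le_mul_of_nonneg_left (h l hl) (by positivity : 0 ≤ 2 * l)
      have h2 : 2 * l * (l / 2 * P + 1 / (2 * l) * Q) = P * (l * l) + Q := by
        field_simp
      linarith
  rw [discrim] at hd
  nlinarith

end

section

open MeasureTheory Measure Set Filter Function
open scoped NNReal ENNReal ComplexConjugate

/-! ### The energy balance -/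

variable {ι : Type*} {Ω : Set E3} {Ωp : ι → Set E3} {κ ρ : ι → E3 → ℝ} {d : Fin 3 → ℝ → ℝ}
  {r β : ℝ} {s : ℂ} {F : ι → E3 → ℂ} {f : ι → Fin 3 → E3 → ℂ} {u : ι → E3 → ℂ}

/-- The empty set has no least upper bound in ℝ, so at least one nonnegative value is attained. -/
theorem nonneg_of_isLUB_betaValues (hβ : IsLUB (betaValues Ωp κ ρ d) β) : 0 ≤ β := by
  obtain ⟨v, hv⟩ := hβ.nonempty
  have h1 := hβ.1 hv
  obtain ⟨i, x, -, η, rfl⟩ := hv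
  exact le_trans (by positivity) h1

/-- Clears the denominator in β. Where d_η = 0 the quotient carries no information, but d_η is then
minimal and its derivative vanishes. -/
theorem IsDamping.sqrt_mul_abs_deriv_le (hd : IsDamping Ωp d)
    (hβ : IsLUB (betaValues Ωp κ ρ d) β) {i : ι} {x : E3} (hx : x ∈ Ωp i) (η : Fin 3) :
    √(κ i x / ρ i x) * |deriv (d η) (x η)| ≤ β * d η (x η) := by
  rcases (hd.nonneg η (x η)).eq_or_lt with h0 | hpos
  · have hmin : IsLocalMin (d η) (x η) := Eventually.of_forall fun t => by
      rw [← h0]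
      exact hd.nonneg η t
    rw [hmin.deriv_eq_zero, ← h0]
    simp
  · have h1 := hβ.1 ⟨i, x, hx, η, rfl⟩
    rw [abs_div, abs_of_pos hpos, ← mul_div_assoc, div_le_iff₀ hpos] at h1
    exact h1

/-- The density of `E_f²`. -/
def forcingDensity (κ ρ : E3 → ℝ) (d : Fin 3 → ℝ → ℝ) (s : ℂ) (F : E3 → ℂ) (f : Fin 3 → E3 → ℂ)
    (x : E3) : ℝ :=
  1 / κ x * ‖F x‖ ^ 2 + ∑ η, ρ x * ‖s * S d s η x * f η x‖ ^ 2

/-! ### Integrability of the energy, damping and forcing densities. -/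

section Densities

variable {A : Set E3} {k q : E3 → ℝ} {v G : E3 → ℂ} {h : Fin 3 → E3 → ℂ}

theorem integrableOn_forcingDensity (hA : IsLipschitzDomain A)
    (hdc : ∀ η, Continuous (d η)) (hk : ContinuousOn k (closure A)) (hk0 : ∀ x ∈ closure A, 0 < k x)
    (hq : ContinuousOn q (closure A)) (hG : MemLp G 2 (volume.restrict A))
    (hh : ∀ η, ContinuousOn (h η) (closure A)) :
    IntegrableOn (fun x => 1 / k x * ‖G x‖ ^ 2) A ∧
      ∀ η, IntegrableOn (fun x => q x * ‖s * S d s η x * h η x‖ ^ 2) A :=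
  ⟨integrableOn_mul_norm_sq_of_memLp hA
    (continuousOn_const.div hk fun x hx => (hk0 x hx).ne') hG,
    fun η => integrableOn_mul_norm_sq hA hq
      ((continuousOn_const.mul (continuous_S hdc η).continuousOn).mul (hh η))⟩

theorem integrableOn_energyDensity (hA : IsLipschitzDomain A) (hs : 0 < s.re)
    (hd0 : ∀ η t, 0 ≤ d η t) (hdc : ∀ η, Continuous (d η)) (hk : ContinuousOn k (closure A))
    (hk0 : ∀ x ∈ closure A, 0 < k x) (hq : ContinuousOn q (closure A))
    (hq0 : ∀ x ∈ closure A, 0 < q x) (hv : ContDiffOn ℝ 1 v (closure A)) :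
    IntegrableOn (fun x => 1 / k x * ‖s * v x‖ ^ 2) A ∧
      (∀ η, IntegrableOn (fun x => 1 / q x * ‖stretchedGrad A d s v η x‖ ^ 2) A) ∧
      ∀ η, IntegrableOn (fun x => kcoef d s η x / q x * ‖stretchedGrad A d s v η x‖ ^ 2) A :=
  ⟨integrableOn_mul_norm_sq hA (continuousOn_const.div hk fun x hx => (hk0 x hx).ne')
      (continuousOn_const.mul hv.continuousOn),
    fun η => integrableOn_mul_norm_sq hA (continuousOn_const.div hq fun x hx => (hq0 x hx).ne')
      (continuousOn_stretchedGrad hA hs hd0 hdc hv η),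
    fun η => integrableOn_mul_norm_sq hA ((continuous_kcoef hs hd0 hdc η).continuousOn.div hq
      fun x hx => (hq0 x hx).ne') (continuousOn_stretchedGrad hA hs hd0 hdc hv η)⟩

end Densities

theorem continuousOn_divergence {A : Set E3} {W : Fin 3 → E3 → ℝ} (hA : IsOpen A)
    (hW : ∀ η, ContDiffOn ℝ 1 (W η) A) : ContinuousOn (divergence W) A :=
  continuousOn_finsetSum _ fun η _ =>
    ((hW η).continuousOn_fderiv_of_isOpen hA le_rfl).clm_apply continuousOn_const

/-- S_xS_yS_z does not depend on the subdomain, so continuity of u and of the normal components of Φ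
and f suffices. -/
theorem energyField_jump (hf : IsAdmissibleData Ω Ωp r F f)
    (hu : IsSolution Ω Ωp κ ρ d r s F f u) {i j : ι} (hij : i ≠ j) {x : E3} (hx : x ∈ Ω) {n : E3}
    (hi : IsOutwardNormal (Ωp i) x n) (hj : IsOutwardNormal (Ωp j) x (-n)) :
    ∑ η, energyField (Ωp i) (ρ i) d s (u i) (f i) η x * n η
      = ∑ η, energyField (Ωp j) (ρ j) d s (u j) (f j) η x * n η := by
  rw [sum_energyField_mul, sum_energyField_mul, hu.flux_jump i j hij x hx n hi hj,
    hf.normal_jump i j hij x hx n hi hj, hu.jump i j hij x hx hi.1 hj.1]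

theorem energyUSq_eq [Fintype ι]
    (h1 : ∀ i, IntegrableOn (fun x => 1 / κ i x * ‖s * u i x‖ ^ 2) (Ωp i))
    (h2 : ∀ i η, IntegrableOn
      (fun x => 1 / ρ i x * ‖stretchedGrad (Ωp i) d s (u i) η x‖ ^ 2) (Ωp i)) :
    energyUSq Ωp κ ρ d s u
      = ∑ i, ∫ x in Ωp i, energyDensity (Ωp i) (κ i) (ρ i) d s (u i) x := by
  unfold energyUSq normSq energyDensity
  rw [Finset.sum_comm, ← Finset.sum_add_distrib]
  refine Finset.sum_congr rfl fun i _ => ?_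
  rw [integral_add (h1 i) (integrable_finsetSum _ fun η _ => h2 i η),
    integral_finsetSum _ fun η _ => h2 i η]

theorem energyFSq_eq [Fintype ι]
    (h1 : ∀ i, IntegrableOn (fun x => 1 / κ i x * ‖F i x‖ ^ 2) (Ωp i))
    (h2 : ∀ i η, IntegrableOn
      (fun x => ρ i x * ‖s * S d s η x * f i η x‖ ^ 2) (Ωp i)) :
    energyFSq Ωp κ ρ d s F f
      = ∑ i, ∫ x in Ωp i, forcingDensity (κ i) (ρ i) d s (F i) (f i) x := by
  unfold energyFSq normSq forcingDensity
  rw [Finset.sum_comm, ← Finset.sum_add_distrib]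
  refine Finset.sum_congr rfl fun i _ => ?_
  rw [integral_add (h1 i) (integrable_finsetSum _ fun η _ => h2 i η),
    integral_finsetSum _ fun η _ => h2 i η]

theorem dampingSq_eq [Fintype ι] (h : ∀ i η, IntegrableOn
      (fun x => kcoef d s η x / ρ i x * ‖stretchedGrad (Ωp i) d s (u i) η x‖ ^ 2) (Ωp i)) :
    ∑ η, normSq Ωp (fun i x => kcoef d s η x / ρ i x)
        (fun i x => stretchedGrad (Ωp i) d s (u i) η x)
      = ∑ i, ∫ x in Ωp i, dampingDensity (Ωp i) (ρ i) d s (u i) x := by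
  unfold normSq dampingDensity
  rw [Finset.sum_comm]
  exact Finset.sum_congr rfl fun i _ => (integral_finsetSum _ fun η _ => h i η).symm

end

end PML

end

/-! ### The energy estimate. -/

open MeasureTheory

theorem theorem1 {ι : Type*} [Fintype ι] (Ω : Set PML.E3) (Ωp : ι → Set PML.E3)
    (hΩ : PML.IsPartition Ω Ωp)
    (κ ρ : ι → PML.E3 → ℝ)
    (hκ : PML.IsPiecewiseCoefficient Ωp κ) (hρ : PML.IsPiecewiseCoefficient Ωp ρ)
    (d : Fin 3 → ℝ → ℝ) (hd : PML.IsDamping Ωp d)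
    (r : ℝ) (hr : |r| ≤ 1)
    (β : ℝ) (hβ : IsLUB (PML.betaValues Ωp κ ρ d) β)
    (s : ℂ) (hs : β < s.re)
    (F : ι → PML.E3 → ℂ) (f : ι → Fin 3 → PML.E3 → ℂ)
    (hf : PML.IsAdmissibleData Ω Ωp r F f)
    (u : ι → PML.E3 → ℂ) (hu : PML.IsSolution Ω Ωp κ ρ d r s F f u) :
    (∀ i, MeasureTheory.IntegrableOn
        (PML.boundaryIntegrand Ω (κ i) (ρ i) d r s (u i))
        (frontier Ω ∩ frontier (Ωp i)) μHE[2]) ∧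
    0 ≤ PML.boundaryTerm Ω Ωp κ ρ d r s u ∧
    (s.re - β) * PML.energyUSq Ωp κ ρ d s u
        + ∑ η, PML.normSq Ωp (fun i x => PML.kcoef d s η x / ρ i x)
            (fun i x => PML.stretchedGrad (Ωp i) d s (u i) η x)
        + PML.boundaryTerm Ω Ωp κ ρ d r s u
      ≤ 2 * Real.sqrt (PML.energyUSq Ωp κ ρ d s u)
          * Real.sqrt (PML.energyFSq Ωp κ ρ d s F f) := by
  have hβ0 := PML.nonneg_of_isLUB_betaValues hβ
  have hs0 : 0 < s.re := hβ0.trans_lt hs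
  have hd0 := hd.nonneg
  have hdc := hd.continuous
  have hL := hΩ.lipschitz_piece
  set V : ι → Fin 3 → PML.E3 → ℝ := fun i => PML.energyField (Ωp i) (ρ i) d s (u i) (f i) with hV
  have hV1 : ∀ i η, ContDiffOn ℝ 1 (V i η) (Ωp i) := fun i =>
    PML.contDiffOn_energyField (hL i).isOpen hs0 hd0 (hd.contDiffAt i) (hu.contDiffOn i)
      (hu.contDiffOn_flux i) (hf.contDiffOn i)
  have hVc : ∀ i η, ContinuousOn (V i η) (closure (Ωp i)) := fun i =>
    PML.continuousOn_energyField (hL i) hs0 hd0 hdc (hu.contDiffOn i) (hρ i).1 (hρ i).2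
      (hf.continuousOn i)
  have hflux : ∀ i, ∀ᵐ x ∂(μHE[2].restrict (frontier Ω ∩ frontier (Ωp i))),
      ∑ η, V i η x * PML.outwardNormal Ω x η
        = -PML.boundaryIntegrand Ω (κ i) (ρ i) d r s (u i) x := fun i => by
    filter_upwards [hΩ.ae_common_normal i,
      ae_restrict_mem (isClosed_frontier.inter isClosed_frontier).measurableSet] with x hx hxm
    have hxc := frontier_subset_closure hxm.2
    exact PML.sum_energyField_mul_eq_neg_boundaryIntegrand hs0 hd0 ((hκ i).2 x hxc)
      ((hρ i).2 x hxc) hx.1 (hu.boundary i x _ hx.1 hx.2.1)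
      fun h => hf.normal_boundary h i x _ hx.1 hx.2.1
  -- Integrability is inherited from the energy flux, with which the integrand agrees up to sign
  -- almost everywhere.
  have hBI : ∀ i, IntegrableOn (PML.boundaryIntegrand Ω (κ i) (ρ i) d r s (u i))
      (frontier Ω ∩ frontier (Ωp i)) μHE[2] := fun i => by
    have h1 : IntegrableOn (fun x => ∑ η, V i η x * PML.outwardNormal (Ωp i) x η)
        (frontier Ω ∩ frontier (Ωp i)) μHE[2] :=
      IntegrableOn.mono_set (integrable_finsetSum _ fun η _ =>
        (hL i).integrableOn_frontier (hVc i η) η) Set.inter_subset_right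
    refine h1.neg.congr ?_
    filter_upwards [hflux i, hΩ.ae_common_normal i] with x hx hx2
    rw [Pi.neg_apply, hx2.2.2, hx, neg_neg]
  have hBTeq : PML.boundaryTerm Ω Ωp κ ρ d r s u
      = -∑ i, ∫ x in frontier Ω ∩ frontier (Ωp i),
          ∑ η, V i η x * PML.outwardNormal Ω x η ∂μHE[2] := by
    have h1 : ∀ i, ∫ x in frontier Ω ∩ frontier (Ωp i),
          ∑ η, V i η x * PML.outwardNormal Ω x η ∂μHE[2]
        = -∫ x in frontier Ω ∩ frontier (Ωp i),
          PML.boundaryIntegrand Ω (κ i) (ρ i) d r s (u i) x ∂μHE[2] := fun i => by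
      rw [integral_congr_ae (hflux i), integral_neg]
    rw [Finset.sum_congr rfl fun i _ => h1 i, Finset.sum_neg_distrib, neg_neg, PML.boundaryTerm]
    split_ifs with hr1
    -- At r = -1 the factor (1-r)/(1+r) is 0 by the convention for division by zero, in agreement
    -- with the value 0 of the boundary term.
    · refine (Finset.sum_eq_zero fun i _ => integral_eq_zero_of_ae (ae_of_all _ fun x => ?_)).symm
      simp [PML.boundaryIntegrand, hr1]
    · rfl
  have hBT0 : 0 ≤ PML.boundaryTerm Ω Ωp κ ρ d r s u := by
    rw [PML.boundaryTerm]
    split_ifs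
    · exact le_rfl
    · exact Finset.sum_nonneg fun i _ => integral_nonneg fun x =>
        PML.boundaryIntegrand_nonneg hs0 hd0 hr x
  refine ⟨hBI, hBT0, ?_⟩
  have hE := fun i => PML.integrableOn_energyDensity (hL i) hs0 hd0 hdc (hκ i).1 (hκ i).2 (hρ i).1
    (hρ i).2 (hu.contDiffOn i)
  have hG := fun i => PML.integrableOn_forcingDensity (s := s) (hL i) hdc (hκ i).1 (hκ i).2
    (hρ i).1 (hf.memLp i) (hf.continuousOn i)
  have hEi : ∀ i, IntegrableOn (PML.energyDensity (Ωp i) (κ i) (ρ i) d s (u i)) (Ωp i) := fun i =>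
    (hE i).1.add (integrable_finsetSum _ fun η _ => (hE i).2.1 η)
  have hKi : ∀ i, IntegrableOn (PML.dampingDensity (Ωp i) (ρ i) d s (u i)) (Ωp i) := fun i =>
    integrable_finsetSum _ fun η _ => (hE i).2.2 η
  have hGi : ∀ i, IntegrableOn (PML.forcingDensity (κ i) (ρ i) d s (F i) (f i)) (Ωp i) := fun i =>
    (hG i).1.add (integrable_finsetSum _ fun η _ => (hG i).2 η)
  have hpt : ∀ l : ℝ, 0 < l → ∀ i, ∀ x ∈ Ωp i,
      |PML.divergence (V i) x - (s.re * PML.energyDensity (Ωp i) (κ i) (ρ i) d s (u i) x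
          + PML.dampingDensity (Ωp i) (ρ i) d s (u i) x)|
        ≤ β * PML.energyDensity (Ωp i) (κ i) (ρ i) d s (u i) x
          + (l / 2 * PML.energyDensity (Ωp i) (κ i) (ρ i) d s (u i) x
            + 1 / (2 * l) * PML.forcingDensity (κ i) (ρ i) d s (F i) (f i) x) :=
    fun l hl i x hx => by
      have hxc := subset_closure hx
      have h1 := PML.abs_divergence_energyField_sub_le (hL i).isOpen hs0 hd0 (hd.contDiffAt i)
        (hu.contDiffOn i) (hu.contDiffOn_flux i) (hf.contDiffOn i) hx ((hκ i).2 x hxc)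
        ((hρ i).2 x hxc) hβ0 (fun η => hd.sqrt_mul_abs_deriv_le hβ hx η) (hu.equation i x hx)
      exact h1.trans (by gcongr; exact PML.workDensity_le ((hκ i).2 x hxc) ((hρ i).2 x hxc) hl)
  -- Neither div f nor the divergence of the flux is assumed integrable. Only their combination in
  -- the equation is controlled, through the pointwise balance, here with l = 1.
  have hdiv : ∀ i, IntegrableOn (PML.divergence (V i)) (Ωp i) := fun i => by
    have h1 : IntegrableOn (fun x => PML.divergence (V i) x
        - (s.re * PML.energyDensity (Ωp i) (κ i) (ρ i) d s (u i) x
          + PML.dampingDensity (Ωp i) (ρ i) d s (u i) x)) (Ωp i) := by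
      refine Integrable.mono' (((hEi i).const_mul β).add (((hEi i).const_mul (1 / 2)).add
        ((hGi i).const_mul (1 / (2 * 1))))) ?_ ?_
      · refine AEStronglyMeasurable.sub ?_ (((hEi i).const_mul _).add (hKi i)).aestronglyMeasurable
        exact (PML.continuousOn_divergence (hL i).isOpen (hV1 i)).aestronglyMeasurable
          (hL i).isOpen.measurableSet
      · filter_upwards [ae_restrict_mem (hL i).isOpen.measurableSet] with x hx
        exact hpt 1 one_pos i x hx
    refine (h1.add (((hEi i).const_mul s.re).add (hKi i))).congr (ae_of_all _ fun x => ?_)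
    simp
  have hGG := hΩ.sum_integral_divergence hV1 hVc hdiv fun i j hij x hx n hi hj =>
    PML.energyField_jump hf hu hij hx hi hj
  rw [PML.energyUSq_eq (fun i => (hE i).1) (fun i => (hE i).2.1),
    PML.energyFSq_eq (fun i => (hG i).1) (fun i => (hG i).2),
    PML.dampingSq_eq (fun i => (hE i).2.2)]
  set EU := ∑ i, ∫ x in Ωp i, PML.energyDensity (Ωp i) (κ i) (ρ i) d s (u i) x with hEU
  set EF := ∑ i, ∫ x in Ωp i, PML.forcingDensity (κ i) (ρ i) d s (F i) (f i) x with hEF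
  set KD := ∑ i, ∫ x in Ωp i, PML.dampingDensity (Ωp i) (ρ i) d s (u i) x with hKD
  have hEU0 : 0 ≤ EU := Finset.sum_nonneg fun i _ =>
    setIntegral_nonneg (hL i).isOpen.measurableSet fun x hx => by
      have h1 := (hκ i).2 x (subset_closure hx)
      have h2 := (hρ i).2 x (subset_closure hx)
      unfold PML.energyDensity
      positivity
  have hEF0 : 0 ≤ EF := Finset.sum_nonneg fun i _ =>
    setIntegral_nonneg (hL i).isOpen.measurableSet fun x hx => by
      have h1 := (hκ i).2 x (subset_closure hx)
      have h2 := (hρ i).2 x (subset_closure hx)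
      unfold PML.forcingDensity
      positivity
  have hmain : (s.re - β) * EU + KD + PML.boundaryTerm Ω Ωp κ ρ d r s u ≤ √EU * √EF := by
    refine PML.le_sqrt_mul_sqrt hEU0 hEF0 fun l hl => ?_
    have h1 : ∀ i, (s.re - β) * (∫ x in Ωp i, PML.energyDensity (Ωp i) (κ i) (ρ i) d s (u i) x)
        + (∫ x in Ωp i, PML.dampingDensity (Ωp i) (ρ i) d s (u i) x)
        - (l / 2 * (∫ x in Ωp i, PML.energyDensity (Ωp i) (κ i) (ρ i) d s (u i) x)
          + 1 / (2 * l) * ∫ x in Ωp i, PML.forcingDensity (κ i) (ρ i) d s (F i) (f i) x)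
        ≤ ∫ x in Ωp i, PML.divergence (V i) x := fun i => by
      have hi1 := ((hEi i).const_mul (s.re - β)).add (hKi i)
      have hi2 := ((hEi i).const_mul (l / 2)).add ((hGi i).const_mul (1 / (2 * l)))
      rw [← integral_const_mul, ← integral_const_mul, ← integral_const_mul,
        ← integral_add ((hEi i).const_mul (s.re - β)) (hKi i),
        ← integral_add ((hEi i).const_mul (l / 2)) ((hGi i).const_mul (1 / (2 * l)))]
      refine (integral_sub hi1 hi2).symm.trans_le ?_
      refine setIntegral_mono_on (hi1.sub hi2) (hdiv i) (hL i).isOpen.measurableSet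
        fun x hx => ?_
      have := (abs_le.1 (hpt l hl i x hx)).1
      simp only [Pi.add_apply]
      linarith
    have h2 := Finset.sum_le_sum fun i (_ : i ∈ Finset.univ) => h1 i
    rw [hGG, Finset.sum_sub_distrib, Finset.sum_add_distrib, Finset.sum_add_distrib,
      ← Finset.mul_sum, ← Finset.mul_sum, ← Finset.mul_sum] at h2
    linarith
  -- The bound holds with constant 1; the factor 2 is slack.
  refine hmain.trans ?_
  nlinarith [mul_nonneg (Real.sqrt_nonneg EU) (Real.sqrt_nonneg EF)]
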